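/- Let $T\ge 1$ be an integer and let $\delta_1,\delta_2>0$. There are constants $\kappa_1,\kappa_2>0$, depending only on $T,\delta_1,\delta_2$ (in particular not on $n$), such that the following holds for every $n\ge 2$. Write $g(x)=(1+e^{-x})^{-1}$, applied entrywise to matrices; let $\|\cdot\|_*$ denote the nuclear norm (sum of the singular values) and $\|\cdot\|_F$ the Frobenius norm. Let $C_n>0$, let $$\mathcal K=\{M\in\mathbb R^{n\times n}: \|M\|_*\le C_n n,\ M=-M^{\top}\},$$ and let $M^*=(m^*_{ij})\in\mathcal K$ and $\Pi^*=g(M^*)$. Let $0\le p_n\le q_n\le 1$ satisfy $q_n\le\delta_1p_n$ and $\frac{\log n}{n}\le\delta_2p_n$, and let $p_{ij,n}=p_{ji,n}\in[0,1]$ satisfy $p_{ij,n}\in[p_n,q_n]$ for all $i\ne j$. Let $n_{ij}=n_{ji}$ be the number of comparisons between subjects $i$ and $j$, and $y_{ij}$ the number of those won by $i$, so that $y_{ij}+y_{ji}=n_{ij}$ for $i\neq j$. Suppose that the pairs $(n_{ij},y_{ij})$, $i<j$, are independent, that $n_{ij}\sim\mathrm{Binomial}(T,p_{ij,n})$, and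 that, given $n_{ij}$, $y_{ij}\sim\mathrm{Binomial}(n_{ij},g(m^*_{ij}))$. Put $$\mathcal L(M)=\sum_{i=1}^n\sum_{j>i}\bigl(y_{ij}\log g(m_{ij})+(n_{ij}-y_{ij})\log(1-g(m_{ij}))\bigr).$$ Then, with probability at least $1-\kappa_1/n$, $\mathcal L$ has a maximizer over $\mathcal K$, and every maximizer $\hat M$ of $\mathcal L$ over $\mathcal K$ satisfies, with $\hat\Pi=g(\hat M)$, $$\frac1{n^2-n}\,\|\hat\Pi-\Pi^*\|_F^2\le\kappa_2\,C_n\sqrt{\frac1{p_n n}}.$$ -/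

import Mathlib

open MeasureTheory ProbabilityTheory unitInterval

noncomputable section

/-- The nuclear norm of a real square matrix: the sum of its singular values. -/
def nuclearNorm {n : ℕ} (M : Matrix (Fin n) (Fin n) ℝ) : ℝ :=
  ∑ k ∈ Finset.range n, (Matrix.toEuclideanLin M).singularValues k

/-- The squared Frobenius norm: the sum of the squared entries. -/
def frobeniusSq {n : ℕ} (A : Matrix (Fin n) (Fin n) ℝ) : ℝ :=
  ∑ i, ∑ j, (A i j) ^ 2

/-- The matrix of winning probabilities `π i j = g (m i j)`, `g x = 1 / (1 + exp (-x))`. -/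
def winProb {n : ℕ} (M : Matrix (Fin n) (Fin n) ℝ) : Matrix (Fin n) (Fin n) ℝ :=
  M.map Real.sigmoid

/-- The parameter space: skew-symmetric matrices with nuclear norm at most `C * n`. -/
def paramSpace (n : ℕ) (C : ℝ) : Set (Matrix (Fin n) (Fin n) ℝ) :=
  {M | nuclearNorm M ≤ C * n ∧ M = -M.transpose}

/-- The log-likelihood of `M`, given the numbers `N i j` of comparisons and the numbers `Y i j` of
wins of `i` over `j`. -/
def logLik {n : ℕ} (N Y : Fin n → Fin n → ℕ) (M : Matrix (Fin n) (Fin n) ℝ) : ℝ :=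
  ∑ i, ∑ j ∈ Finset.Ioi i,
    ((Y i j : ℝ) * Real.log (Real.sigmoid (M i j)) +
      ((N i j : ℝ) - (Y i j : ℝ)) * Real.log (1 - Real.sigmoid (M i j)))

/-- `Mhat` maximizes the log-likelihood over the parameter space. -/
def IsConstrainedMLE {n : ℕ} (C : ℝ) (N Y : Fin n → Fin n → ℕ)
    (Mhat : Matrix (Fin n) (Fin n) ℝ) : Prop :=
  Mhat ∈ paramSpace n C ∧ IsMaxOn (logLik N Y) (paramSpace n C) Mhat

/-- The pairwise comparison model: `N i j` is the number of comparisons of `i` and `j`, and `Y i j`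
the number of those that `i` wins. The pairs `(N i j, Y i j)`, `i < j`, are independent,
`N i j` is Binomial `(T, P i j)`, and given `N i j` the count `Y i j` is
Binomial `(N i j, g (M i j))`. -/
structure IsComparisonModel {n : ℕ} {Ω : Type*} [MeasurableSpace Ω] (μ : Measure Ω) (T : ℕ)
    (P : Fin n → Fin n → I) (M : Matrix (Fin n) (Fin n) ℝ)
    (N Y : Fin n → Fin n → Ω → ℕ) : Prop where
  measurable_N : ∀ i j, Measurable (N i j)
  measurable_Y : ∀ i j, Measurable (Y i j)
  symm : ∀ i j ω, N i j ω = N j i ω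
  wins_add : ∀ i j ω, i ≠ j → Y i j ω + Y j i ω = N i j ω
  indep : iIndepFun
    (fun (e : {e : Fin n × Fin n // e.1 < e.2}) (ω : Ω) =>
      (N e.1.1 e.1.2 ω, Y e.1.1 e.1.2 ω)) μ
  law_N : ∀ i j, i < j → HasLaw (N i j) (binomial T (P i j)) μ
  cond_law_Y : ∀ i j, i < j → ∀ k l : ℕ,
    μ.real {ω | N i j ω = k ∧ Y i j ω = l} =
      μ.real {ω | N i j ω = k} * (binomial k (unitInterval.sigmoid (M i j))).real {l}

end

/-!
The maximizer exists because the parameter space is compact: by the duality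
`sum_mul_le_norm_mul_nuclearNorm` of the spectral and the nuclear norm, which is attained
(`exists_norm_le_one_sum_mul_eq_nuclearNorm`), it is an intersection of closed half-spaces.

For the error bound, write the likelihood in terms of the logits as `y m - n log (1 + exp m)`. The
expectation of `L(M) - L(M*)` is minus a weighted sum of Kullback-Leibler divergences, hence at most
`-T p ‖g(M) - g(M*)‖_F²` (`two_mul_sq_sigmoid_sub_le`). A maximizer has `L(M) - L(M*) ≥ 0`, so its
error is at most the supremum over the parameter space of the centred process
`L(M) - L(M*) - E[L(M) - L(M*)]`, divided by `T p` (`mul_frobeniusSq_le`).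

The supremum is controlled through its moment of order `2 k`, where `k` is of the order of
`n q + log n`. Symmetrization and the Ledoux-Talagrand contraction principle
(`prodExp_maxEntry_le`) replace the process by the linear Rademacher process
`2 ∑ ε_ij n_ij (m_ij - m*_ij)`, which by duality is at most `4 C n` times the spectral norm of the
random matrix `(ε_ij n_ij)_{i<j}`. The moments of that norm are computed by the trace method
(`prodExp_signExp_norm_pow_le`): only closed walks that use every edge an even number of times
contribute, and their number is compared, shape by shape, with that for the `2 k × 2 k` matrix of
random signs. The norm of the latter is of the order of `√k` by a net argument
(`signExp_norm_pow_le`), so the norm of `(ε_ij n_ij)_{i<j}` is `O(T √k)`. This comparison loses no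
logarithmic factor, and Markov's inequality with `k ≥ log n` gives the probability `1 - 1 / n`
(`one_sub_le_measureReal_mle`).

All the expectations are finite sums, since the counts take finitely many values.
-/

/-! ### Nuclear norm, compactness and the logistic link -/

/-- The entrywise pairing of two matrices is the trace of `UᵀM`, in any orthonormal basis. -/
theorem sum_inner_apply_eq {n : ℕ} (U M : Matrix (Fin n) (Fin n) ℝ)
    (b : OrthonormalBasis (Fin n) ℝ (EuclideanSpace ℝ (Fin n))) :
    ∑ i, ∑ j, U i j * M i j =
      ∑ k, inner ℝ (Matrix.toEuclideanLin U (b k)) (Matrix.toEuclideanLin M (b k)) := by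
  have h : ∀ b : OrthonormalBasis (Fin n) ℝ (EuclideanSpace ℝ (Fin n)),
      ∑ k, inner ℝ (Matrix.toEuclideanLin U (b k)) (Matrix.toEuclideanLin M (b k)) =
      LinearMap.trace ℝ _ ((Matrix.toEuclideanLin U).adjoint ∘ₗ Matrix.toEuclideanLin M) := by
    intro b
    rw [LinearMap.trace_eq_sum_inner _ b]
    simp [LinearMap.adjoint_inner_right]
  rw [h b, ← h (EuclideanSpace.basisFun (Fin n) ℝ), Finset.sum_comm]
  simp [PiLp.inner_apply, Matrix.toLpLin_apply, mul_comm]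

/-- An orthonormal eigenbasis of `MᵀM`. -/
noncomputable def rightSingularBasis {n : ℕ} (M : Matrix (Fin n) (Fin n) ℝ) :
    OrthonormalBasis (Fin n) ℝ (EuclideanSpace ℝ (Fin n)) :=
  (Matrix.toEuclideanLin M).isSymmetric_adjoint_comp_self.eigenvectorBasis
    (finrank_euclideanSpace_fin (𝕜 := ℝ) (n := n))

theorem inner_apply_rightSingularBasis {n : ℕ} (M : Matrix (Fin n) (Fin n) ℝ) (k l : Fin n) :
    inner ℝ (Matrix.toEuclideanLin M (rightSingularBasis M k))
      (Matrix.toEuclideanLin M (rightSingularBasis M l)) =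
      if k = l then (Matrix.toEuclideanLin M).singularValues k ^ 2 else 0 := by
  have h := (Matrix.toEuclideanLin M).isSymmetric_adjoint_comp_self.apply_eigenvectorBasis
    (finrank_euclideanSpace_fin (𝕜 := ℝ) (n := n)) l
  rw [← LinearMap.adjoint_inner_right]
  change inner ℝ _ (((Matrix.toEuclideanLin M).adjoint ∘ₗ Matrix.toEuclideanLin M) _) = _
  rw [rightSingularBasis, h, inner_smul_right, LinearMap.sq_singularValues_fin _
    (finrank_euclideanSpace_fin (𝕜 := ℝ) (n := n)), orthonormal_iff_ite.mp
    (OrthonormalBasis.orthonormal _)]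
  split_ifs with hkl <;> simp [hkl]

theorem norm_apply_rightSingularBasis {n : ℕ} (M : Matrix (Fin n) (Fin n) ℝ) (k : Fin n) :
    ‖Matrix.toEuclideanLin M (rightSingularBasis M k)‖ =
      (Matrix.toEuclideanLin M).singularValues k := by
  have h := inner_apply_rightSingularBasis M k k
  rw [real_inner_self_eq_norm_sq, if_pos rfl] at h
  exact (sq_eq_sq₀ (norm_nonneg _) (LinearMap.singularValues_nonneg _ _)).mp h

/-- Duality of the spectral and the nuclear norm: expand the pairing in the right singular basis of
`M`. -/
theorem sum_mul_le_norm_mul_nuclearNorm {n : ℕ} (U M : Matrix (Fin n) (Fin n) ℝ) :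
    ∑ i, ∑ j, U i j * M i j ≤ ‖Matrix.toEuclideanCLM (𝕜 := ℝ) U‖ * nuclearNorm M := by
  rw [sum_inner_apply_eq U M (rightSingularBasis M), nuclearNorm, Finset.sum_range, Finset.mul_sum]
  refine Finset.sum_le_sum fun k _ => (real_inner_le_norm _ _).trans ?_
  rw [norm_apply_rightSingularBasis]
  refine mul_le_mul_of_nonneg_right ?_ (LinearMap.singularValues_nonneg _ _)
  have := (Matrix.toEuclideanCLM (𝕜 := ℝ) U).le_opNorm (rightSingularBasis M k)
  rwa [OrthonormalBasis.norm_eq_one, mul_one] at this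

/-- The norm duality is attained, by the partial isometry of the polar decomposition. -/
theorem exists_norm_le_one_sum_mul_eq_nuclearNorm {n : ℕ} (M : Matrix (Fin n) (Fin n) ℝ) :
    ∃ U : Matrix (Fin n) (Fin n) ℝ, ‖Matrix.toEuclideanCLM (𝕜 := ℝ) U‖ ≤ 1 ∧
      ∑ i, ∑ j, U i j * M i j = nuclearNorm M := by
  set b := rightSingularBasis M
  set s := fun k : Fin n => (Matrix.toEuclideanLin M).singularValues k
  set u : Fin n → EuclideanSpace ℝ (Fin n) := fun k => (s k)⁻¹ • Matrix.toEuclideanLin M (b k)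
  have hu : ∀ k l, inner ℝ (u k) (u l) = if k = l ∧ s k ≠ 0 then (1 : ℝ) else 0 := by
    intro k l
    simp only [u, inner_smul_left, inner_smul_right, b, inner_apply_rightSingularBasis]
    by_cases hkl : k = l
    · subst hkl
      by_cases h0 : s k = 0
      · simp [h0]
      · simp only [s] at h0 ⊢
        simp [h0]; field_simp
    · simp [hkl]
  set L : EuclideanSpace ℝ (Fin n) →ₗ[ℝ] EuclideanSpace ℝ (Fin n) := b.toBasis.constr ℝ u
  have hLb : ∀ k, L (b k) = u k := fun k => by
    have := b.toBasis.constr_basis ℝ u k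
    rwa [b.coe_toBasis] at this
  have hL : ∀ x, ‖L x‖ ≤ ‖x‖ := by
    intro x
    have hx : L x = ∑ k, (b.repr x k) • u k := by
      conv_lhs => rw [← b.sum_repr x]
      simp [map_sum, hLb]
    refine (sq_le_sq₀ (norm_nonneg _) (norm_nonneg _)).mp ?_
    rw [← real_inner_self_eq_norm_sq, hx, ← b.repr.norm_map x, EuclideanSpace.norm_sq_eq]
    simp only [sum_inner, inner_sum, inner_smul_left, inner_smul_right, hu]
    refine Finset.sum_le_sum fun k _ => ?_
    rw [Finset.sum_eq_single k]
    · by_cases h0 : s k = 0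
      · simp [h0, sq_nonneg]
      · simp [h0, sq]
    · intro l _ hl
      simp [hl]
    · simp
  refine ⟨Matrix.toEuclideanLin.symm L, ?_, ?_⟩
  · refine ContinuousLinearMap.opNorm_le_bound _ zero_le_one fun x => ?_
    have : Matrix.toEuclideanCLM (𝕜 := ℝ) (Matrix.toEuclideanLin.symm L) x = L x := by
      change Matrix.toEuclideanLin (Matrix.toEuclideanLin.symm L) x = L x
      simp
    rw [this, one_mul]
    exact hL x
  · rw [sum_inner_apply_eq _ M b, nuclearNorm, Finset.sum_range]
    refine Finset.sum_congr rfl fun k _ => ?_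
    rw [LinearEquiv.apply_symm_apply, hLb]
    simp only [u, inner_smul_left, b, inner_apply_rightSingularBasis, s]
    by_cases h0 : (Matrix.toEuclideanLin M).singularValues k = 0
    · simp [h0]
    · simp; field_simp

theorem abs_apply_le_nuclearNorm {n : ℕ} (M : Matrix (Fin n) (Fin n) ℝ) (i j : Fin n) :
    |M i j| ≤ nuclearNorm M := by
  have h : ∀ c : ℝ, |c| ≤ 1 → c * M i j ≤ nuclearNorm M := by
    intro c hc
    have h1 := sum_mul_le_norm_mul_nuclearNorm (Matrix.single i j c) M
    have h2 : ‖Matrix.toEuclideanCLM (𝕜 := ℝ) (Matrix.single i j c)‖ ≤ 1 := by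
      refine ContinuousLinearMap.opNorm_le_bound _ zero_le_one fun x => ?_
      have : Matrix.toEuclideanCLM (𝕜 := ℝ) (Matrix.single i j c) x =
          EuclideanSpace.single i (c * x j) := by
        ext k
        simp [Matrix.single_mulVec, Function.update_apply]
      rw [this, PiLp.norm_single, norm_mul, one_mul]
      calc ‖c‖ * ‖x j‖ ≤ 1 * ‖x‖ := by
            gcongr
            · exact hc
            · exact PiLp.norm_apply_le x j
        _ = ‖x‖ := one_mul _
    have h3 : 0 ≤ nuclearNorm M :=
      Finset.sum_nonneg fun k _ => LinearMap.singularValues_nonneg _ _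
    have h4 : ∑ a, ∑ b, Matrix.single i j c a b * M a b = c * M i j := by
      rw [Finset.sum_eq_single i, Finset.sum_eq_single j]
      · simp
      · intro b _ hb; simp [Matrix.single, Ne.symm hb]
      · simp
      · intro a _ ha; simp [Matrix.single, Ne.symm ha]
      · simp
    rw [h4] at h1
    exact h1.trans (mul_le_of_le_one_left h3 h2)
  rcases abs_cases (M i j) with ⟨h1, _⟩ | ⟨h1, _⟩
  · rw [h1]; simpa using h 1 (by simp)
  · rw [h1]; simpa using h (-1) (by simp)

theorem isCompact_paramSpace (n : ℕ) (C : ℝ) : IsCompact (paramSpace n C) := by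
  have hbox : IsCompact (Set.univ.pi fun _ : Fin n => Set.univ.pi fun _ : Fin n =>
      Set.Icc (-(C * n)) (C * n)) :=
    isCompact_univ_pi fun _ => isCompact_univ_pi fun _ => isCompact_Icc
  refine IsCompact.of_isClosed_subset hbox ?_ ?_
  · have : paramSpace n C = (⋂ U ∈ {U : Matrix (Fin n) (Fin n) ℝ |
        ‖Matrix.toEuclideanCLM (𝕜 := ℝ) U‖ ≤ 1}, {M | ∑ i, ∑ j, U i j * M i j ≤ C * n}) ∩
        {M | M = -M.transpose} := by
      ext M
      simp only [paramSpace, Set.mem_ofPred_eq, Set.mem_inter_iff, Set.mem_iInter]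
      refine and_congr_left fun _ => ⟨fun h U hU => ?_, fun h => ?_⟩
      · refine (sum_mul_le_norm_mul_nuclearNorm U M).trans ((mul_le_of_le_one_left ?_ hU).trans h)
        exact Finset.sum_nonneg fun k _ => LinearMap.singularValues_nonneg _ _
      · obtain ⟨U, hU, hUM⟩ := exists_norm_le_one_sum_mul_eq_nuclearNorm M
        exact hUM ▸ h U hU
    rw [this]
    refine IsClosed.inter (isClosed_biInter fun U _ => isClosed_le ?_ continuous_const)
      (isClosed_eq continuous_id (Continuous.neg (Continuous.matrix_transpose continuous_id)))
    fun_prop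
  · intro M hM i _ j _
    exact abs_le.mp ((abs_apply_le_nuclearNorm M i j).trans hM.1)

theorem continuous_logLik {n : ℕ} (N Y : Fin n → Fin n → ℕ) : Continuous (logLik N Y) := by
  unfold logLik
  refine continuous_finsetSum _ fun i _ => continuous_finsetSum _ fun j _ => ?_
  have hs : Continuous fun M : Matrix (Fin n) (Fin n) ℝ => Real.sigmoid (M i j) :=
    continuous_sigmoid.comp (by fun_prop)
  refine ((hs.log fun M => (Real.sigmoid_pos _).ne').const_mul _).add
    (((continuous_const.sub hs).log fun M => ?_).const_mul _)
  exact (sub_pos.mpr (Real.sigmoid_lt_one _)).ne'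

theorem exists_isConstrainedMLE {n : ℕ} {C : ℝ} {M₀ : Matrix (Fin n) (Fin n) ℝ}
    (h₀ : M₀ ∈ paramSpace n C) (N Y : Fin n → Fin n → ℕ) :
    ∃ M, IsConstrainedMLE C N Y M :=
  (isCompact_paramSpace n C).exists_isMaxOn ⟨M₀, h₀⟩ (continuous_logLik N Y).continuousOn

/-- The softplus function `x ↦ log (1 + exp x)`, an antiderivative of the sigmoid. -/
noncomputable def softplus (x : ℝ) : ℝ := Real.log (1 + Real.exp x)

theorem log_one_sub_sigmoid (x : ℝ) : Real.log (1 - Real.sigmoid x) = -softplus x := by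
  rw [← Real.sigmoid_neg, Real.sigmoid_def, neg_neg, Real.log_inv, softplus]

theorem log_sigmoid (x : ℝ) : Real.log (Real.sigmoid x) = x - softplus x := by
  have h := Real.sigmoid_mul_rexp_neg x
  have h2 := log_one_sub_sigmoid x
  rw [← Real.sigmoid_neg, ← h, Real.log_mul (Real.sigmoid_pos x).ne' (Real.exp_pos _).ne',
    Real.log_exp] at h2
  linarith

theorem hasDerivAt_softplus (x : ℝ) : HasDerivAt softplus (Real.sigmoid x) x := by
  have h := ((Real.hasDerivAt_exp x).const_add 1).log (by positivity)
  refine h.congr_deriv ?_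
  rw [Real.sigmoid_def, Real.exp_neg]
  field_simp
  ring

/-- The logistic Bregman divergence (that is, the Kullback-Leibler divergence of two Bernoulli laws)
dominates twice the squared difference of the means. -/
theorem two_mul_sq_sigmoid_sub_le (a b : ℝ) :
    2 * (Real.sigmoid b - Real.sigmoid a) ^ 2 ≤
      softplus b - softplus a - Real.sigmoid a * (b - a) := by
  set h : ℝ → ℝ := fun x => softplus x - softplus a - Real.sigmoid a * (x - a) -
    2 * (Real.sigmoid x - Real.sigmoid a) ^ 2 with hh
  have hd : ∀ x, HasDerivAt h ((Real.sigmoid x - Real.sigmoid a) *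
      (1 - 2 * Real.sigmoid x) ^ 2) x := by
    intro x
    have h1 := (((hasDerivAt_softplus x).sub_const (softplus a)).sub
      (((hasDerivAt_id x).sub_const a).const_mul (Real.sigmoid a))).sub
      ((((Real.hasDerivAt_sigmoid x).sub_const (Real.sigmoid a)).pow 2).const_mul 2)
    refine h1.congr_deriv ?_
    simp; ring
  have hc : Continuous h := continuous_iff_continuousAt.mpr fun x => (hd x).continuousAt
  have ha : h a = 0 := by simp [hh]
  suffices 0 ≤ h b by simp only [hh] at this; linarith
  rw [← ha]
  rcases le_total a b with hab | hab
  · refine monotoneOn_of_hasDerivWithinAt_nonneg (convex_Icc a b) hc.continuousOn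
      (fun x _ => (hd x).hasDerivWithinAt) ?_ ⟨le_rfl, hab⟩ ⟨hab, le_rfl⟩ hab
    intro x hx
    rw [interior_Icc] at hx
    exact mul_nonneg (sub_nonneg.mpr (Real.sigmoid_le hx.1.le)) (sq_nonneg _)
  · refine antitoneOn_of_hasDerivWithinAt_nonpos (convex_Icc b a) hc.continuousOn
      (fun x _ => (hd x).hasDerivWithinAt) ?_ ⟨le_rfl, hab⟩ ⟨hab, le_rfl⟩ hab
    intro x hx
    rw [interior_Icc] at hx
    exact mul_nonpos_of_nonpos_of_nonneg (sub_nonpos.mpr (Real.sigmoid_le hx.2.le)) (sq_nonneg _)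

/-- The single-comparison log-likelihood, `y` wins in `n` trials, is `n`-Lipschitz in the logit. -/
theorem abs_mul_sub_mul_softplus_sub_le {n y : ℝ} (hy : 0 ≤ y) (hyn : y ≤ n) (a b : ℝ) :
    |(y * a - n * softplus a) - (y * b - n * softplus b)| ≤ n * |a - b| := by
  have h := convex_univ.norm_image_sub_le_of_norm_hasDerivWithin_le (𝕜 := ℝ)
    (f := fun x => y * x - n * softplus x) (f' := fun x => y - n * Real.sigmoid x) (C := n)
    (fun x _ => ?_) (fun x _ => ?_) (Set.mem_univ b) (Set.mem_univ a)
  · simpa [Real.norm_eq_abs] using h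
  · refine HasDerivAt.hasDerivWithinAt ((((hasDerivAt_id x).const_mul y).sub
      ((hasDerivAt_softplus x).const_mul n)).congr_deriv ?_)
    simp
  · rw [Real.norm_eq_abs, abs_le]
    have := Real.sigmoid_nonneg x
    have := Real.sigmoid_le_one x
    constructor <;> nlinarith

/-! ### Symmetrization and contraction over finite product spaces -/

/-- The expectation of `G` under the product of the weights `w e`, on a finite product space. -/
noncomputable def prodExp {ι V : Type*} [Fintype ι] [DecidableEq ι] [Fintype V]
    (w : ι → V → ℝ) (G : (ι → V) → ℝ) : ℝ :=
  ∑ x : ι → V, (∏ e, w e (x e)) * G x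

section prodExp
variable {ι V : Type*} [Fintype ι] [DecidableEq ι] [Fintype V] {w : ι → V → ℝ}

theorem prodExp_mono (hw : ∀ e v, 0 ≤ w e v) {G H : (ι → V) → ℝ} (h : ∀ x, G x ≤ H x) :
    prodExp w G ≤ prodExp w H :=
  Finset.sum_le_sum fun x _ =>
    mul_le_mul_of_nonneg_left (h x) (Finset.prod_nonneg fun e _ => hw e _)

theorem prodExp_sum {κ : Type*} (s : Finset κ) (G : κ → (ι → V) → ℝ) :
    prodExp w (fun x => ∑ t ∈ s, G t x) = ∑ t ∈ s, prodExp w (G t) := by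
  simp only [prodExp, Finset.mul_sum]
  exact Finset.sum_comm

theorem prodExp_mul_left (c : ℝ) (G : (ι → V) → ℝ) :
    prodExp w (fun x => c * G x) = c * prodExp w G := by
  simp only [prodExp, Finset.mul_sum]
  exact Finset.sum_congr rfl fun x _ => by ring

theorem prodExp_prod (g : ι → V → ℝ) :
    prodExp w (fun x => ∏ e, g e (x e)) = ∏ e, ∑ v, w e v * g e v := by
  simp only [prodExp, ← Finset.prod_mul_distrib]
  rw [Finset.prod_univ_sum, Fintype.piFinset_univ]

theorem prodExp_const (hw1 : ∀ e, ∑ v, w e v = 1) (c : ℝ) : prodExp w (fun _ => c) = c := by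
  have h := prodExp_prod (w := w) (fun _ _ => 1)
  simp only [Finset.prod_const_one, mul_one, hw1] at h
  have := prodExp_mul_left (w := w) c (fun _ => 1)
  simpa [h] using this

/-- Fubini for a single coordinate: resampling the coordinate `e` does not change the
expectation. -/
theorem prodExp_eq_prodExp_update (hw1 : ∀ e, ∑ v, w e v = 1) (e : ι) (G : (ι → V) → ℝ) :
    prodExp w G = prodExp w (fun x => ∑ v, w e v * G (Function.update x e v)) := by
  classical
  simp only [prodExp]
  rw [← (Equiv.funSplitAt e V).symm.sum_comp, ← (Equiv.funSplitAt e V).symm.sum_comp]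
  rw [Fintype.sum_prod_type_right, Fintype.sum_prod_type_right]
  refine Finset.sum_congr rfl fun y _ => ?_
  have hprod : ∀ v, ∏ i, w i ((Equiv.funSplitAt e V).symm (v, y) i) =
      w e v * ∏ i : {i // i ≠ e}, w i (y i) := by
    intro v
    rw [Fintype.prod_eq_mul_prod_subtype_ne _ e]
    congr 1
    · simp
    · refine Finset.prod_congr rfl fun i _ => ?_
      simp [i.2]
  have hupd : ∀ v v', Function.update ((Equiv.funSplitAt e V).symm (v, y)) e v' =
      (Equiv.funSplitAt e V).symm (v', y) := by
    intro v v'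
    ext i
    by_cases h : i = e
    · subst h; simp
    · simp [h]
  simp only [hprod, hupd]
  rw [← Finset.sum_mul, ← Finset.sum_mul, hw1, one_mul, Finset.mul_sum]
  exact Finset.sum_congr rfl fun v _ => by ring

end prodExp

/-- Symmetrization of one independent summand: Jensen's inequality applied to an independent copy,
followed by convexity, which splits the difference of the two copies. -/
theorem symmetrization_step {κ V : Type*} [Fintype V] {Φ : (κ → ℝ) → ℝ}
    (hΦ : ConvexOn ℝ Set.univ Φ) {w : V → ℝ}
    (hw : ∀ v, 0 ≤ w v) (hw1 : ∑ v, w v = 1) (a : κ → ℝ) (l : V → κ → ℝ) :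
    ∑ v, w v * Φ (fun t => a t + (l v t - ∑ v', w v' * l v' t)) ≤
      ∑ v, w v * ((Φ (fun t => a t + 2 * l v t) + Φ (fun t => a t - 2 * l v t)) / 2) := by
  have h1 : ∀ v, Φ (fun t => a t + (l v t - ∑ v', w v' * l v' t)) ≤
      ∑ v', w v' * ((Φ (fun t => a t + 2 * l v t) + Φ (fun t => a t - 2 * l v' t)) / 2) := by
    intro v
    have hJ := hΦ.map_sum_le (t := Finset.univ) (w := w)
      (p := fun v' => (fun t => a t + (l v t - l v' t))) (fun v' _ => hw v') hw1
      (fun _ _ => trivial)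
    have he : (fun t => a t + (l v t - ∑ v', w v' * l v' t)) =
        ∑ v', w v' • (fun t => a t + (l v t - l v' t)) := by
      ext t
      simp only [Finset.sum_apply, Pi.smul_apply, smul_eq_mul, mul_add, mul_sub,
        Finset.sum_add_distrib, Finset.sum_sub_distrib, ← Finset.sum_mul, hw1, one_mul]
    rw [he]
    refine hJ.trans (Finset.sum_le_sum fun v' _ => ?_)
    rw [smul_eq_mul]
    refine mul_le_mul_of_nonneg_left ?_ (hw v')
    have := hΦ.2 (Set.mem_univ fun t => a t + 2 * l v t) (Set.mem_univ fun t => a t - 2 * l v' t)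
      (one_half_pos (α := ℝ)).le (one_half_pos (α := ℝ)).le (add_halves 1)
    have he2 : ((1 / 2 : ℝ) • (fun t => a t + 2 * l v t) + (1 / 2 : ℝ) • fun t => a t - 2 * l v' t)
        = fun t => a t + (l v t - l v' t) := by
      ext t
      simp only [Pi.add_apply, Pi.smul_apply, smul_eq_mul]
      ring
    rw [he2] at this
    simp only [smul_eq_mul] at this
    linarith
  refine (Finset.sum_le_sum fun v _ => mul_le_mul_of_nonneg_left (h1 v) (hw v)).trans (le_of_eq ?_)
  have h2 : ∀ v, ∑ v', w v' * ((Φ (fun t => a t + 2 * l v t) + Φ (fun t => a t - 2 * l v' t)) / 2)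
      = Φ (fun t => a t + 2 * l v t) / 2 + ∑ v', w v' * (Φ (fun t => a t - 2 * l v' t) / 2) := by
    intro v
    simp only [add_div, mul_add, Finset.sum_add_distrib, ← Finset.sum_mul, hw1, one_mul]
  simp only [mul_add, Finset.sum_add_distrib, ← Finset.sum_mul, hw1, one_mul, add_div]

section contraction
variable {κ : Type*} [Fintype κ] [Nonempty κ]

/-- The largest entry of a finite family of reals. -/
noncomputable def maxEntry (v : κ → ℝ) : ℝ := Finset.univ.sup' Finset.univ_nonempty v

theorem le_maxEntry (v : κ → ℝ) (t : κ) : v t ≤ maxEntry v :=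
  Finset.le_sup' v (Finset.mem_univ t)

theorem maxEntry_le {v : κ → ℝ} {c : ℝ} (h : ∀ t, v t ≤ c) : maxEntry v ≤ c :=
  Finset.sup'_le _ _ fun t _ => h t

theorem exists_maxEntry_eq (v : κ → ℝ) : ∃ t, maxEntry v = v t := by
  obtain ⟨t, -, ht⟩ := Finset.exists_mem_eq_sup' Finset.univ_nonempty v
  exact ⟨t, ht⟩

theorem convexOn_comp_maxEntry {F : ℝ → ℝ} (hF : ConvexOn ℝ Set.univ F) (hm : Monotone F) :
    ConvexOn ℝ Set.univ (fun v : κ → ℝ => F (maxEntry v)) := by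
  refine ⟨convex_univ, fun v _ v' _ a b ha hb hab => ?_⟩
  refine (hm ?_).trans (hF.2 trivial trivial ha hb hab)
  refine maxEntry_le fun t => ?_
  simp only [Pi.add_apply, Pi.smul_apply, smul_eq_mul]
  exact add_le_add (mul_le_mul_of_nonneg_left (le_maxEntry v t) ha)
    (mul_le_mul_of_nonneg_left (le_maxEntry v' t) hb)

/-- A convex increasing function satisfies the majorization inequality. -/
theorem add_le_add_of_convexOn {F : ℝ → ℝ} (hF : ConvexOn ℝ Set.univ F) (hm : Monotone F)
    {x y x' y' : ℝ} (hx : x ≤ x') (hy : y ≤ x') (hs : x + y ≤ x' + y') :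
    F x + F y ≤ F x' + F y' := by
  rcases le_total y y' with h | h
  · exact add_le_add (hm hx) (hm h)
  have hle : x' + y' - y ≤ x' := by linarith
  have hx2 : F x ≤ F (x' + y' - y) := hm (by linarith)
  rcases eq_or_lt_of_le (h.trans hy) with he | hlt
  · have : y = x' := le_antisymm hy (by linarith)
    subst this
    linarith [hm (show x ≤ y' by linarith)]
  -- `y` and its mirror image `x' + y' - y` are complementary convex combinations of `x'` and `y'`
  set c := (y - y') / (x' - y') with hc
  have hpos : 0 < x' - y' := sub_pos.mpr hlt
  have hc0 : 0 ≤ c := div_nonneg (sub_nonneg.mpr h) hpos.le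
  have hc1 : c ≤ 1 := (div_le_one hpos).mpr (by linarith)
  have hcy : c * (x' - y') = y - y' := div_mul_cancel₀ _ hpos.ne'
  have h1 := hF.2 (x := x') trivial (y := y') trivial hc0 (sub_nonneg.mpr hc1) (by ring)
  have h2 := hF.2 (x := x') trivial (y := y') trivial (sub_nonneg.mpr hc1) hc0 (by ring)
  simp only [smul_eq_mul] at h1 h2
  rw [show c * x' + (1 - c) * y' = y by linarith] at h1
  rw [show (1 - c) * x' + c * y' = x' + y' - y by linarith] at h2
  linarith

/-- The inequality behind the Ledoux-Talagrand contraction step: `A`, `B` are the values, at the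
maximizers of the two terms, of the summand that is kept fixed, and `f`, `f'` and `s`, `s'` those of
the function to be replaced and of its replacement. Optimality gives the hypotheses
`h1` and `h2`. -/
theorem contraction_aux {F : ℝ → ℝ} (hF : ConvexOn ℝ Set.univ F) (hm : Monotone F)
    {A B f f' s s' P Q : ℝ} (hf : |f| ≤ |s|) (hf' : |f'| ≤ |s'|) (hff : |f - f'| ≤ |s - s'|)
    (h1 : B + f' ≤ A + f) (h2 : A - f ≤ B - f')
    (hP : A + s ≤ P) (hP' : B + s' ≤ P) (hQ : A - s ≤ Q) (hQ' : B - s' ≤ Q) :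
    F (A + f) + F (B - f') ≤ F P + F Q := by
  have h3 : B - A ≤ f - f' := by linarith [h1]
  have h4 : A - B ≤ f - f' := by linarith [h2]
  have hf0 := abs_le.mp hf
  have hf1 := abs_le.mp hf'
  have hf2 := abs_le.mp hff
  rcases le_total 0 s with hs | hs <;> rcases le_total 0 s' with hs' | hs' <;>
    rcases le_total s s' with hss | hss <;>
    simp only [abs_of_nonneg, abs_of_nonpos, hs, hs', sub_nonneg, sub_nonpos, hss] at hf0 hf1 hf2
  -- depending on the order of `s`, `s'` and `0`, both terms compare directly or by majorization
  all_goals first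
    | exact add_le_add (hm (by linarith)) (hm (by linarith))
    | (rw [add_comm (F P)]; exact add_le_add (hm (by linarith)) (hm (by linarith)))
    | exact add_le_add_of_convexOn hF hm (by linarith) (by linarith) (by linarith)
    | (rw [add_comm (F P)]
       exact add_le_add_of_convexOn hF hm (by linarith) (by linarith) (by linarith))

/-- The Ledoux-Talagrand contraction principle for one Rademacher variable: replacing a function `φ`
on the index set by a function `s` with larger values and increments can only increase the
expectation of a convex increasing function of the maximum. -/
theorem contraction_step {F : ℝ → ℝ} (hF : ConvexOn ℝ Set.univ F) (hm : Monotone F)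
    (a φ s : κ → ℝ) (hφ : ∀ t, |φ t| ≤ |s t|) (hφs : ∀ t u, |φ t - φ u| ≤ |s t - s u|) :
    F (maxEntry fun t => a t + φ t) + F (maxEntry fun t => a t - φ t) ≤
      F (maxEntry fun t => a t + s t) + F (maxEntry fun t => a t - s t) := by
  obtain ⟨t, ht⟩ := exists_maxEntry_eq fun t => a t + φ t
  obtain ⟨u, hu⟩ := exists_maxEntry_eq fun t => a t - φ t
  have h1 := le_maxEntry (fun t => a t + φ t) u
  have h2 := le_maxEntry (fun t => a t - φ t) t
  rw [ht] at h1 ⊢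
  rw [hu] at h2 ⊢
  exact contraction_aux hF hm (hφ t) (hφ u) (hφs t u) h1 h2
    (le_maxEntry (fun t => a t + s t) t) (le_maxEntry (fun t => a t + s t) u)
    (le_maxEntry (fun t => a t - s t) t) (le_maxEntry (fun t => a t - s t) u)

end contraction

/-- The sign encoded by a Boolean. -/
def boolSign (b : Bool) : ℝ := if b then 1 else -1

/-- The average over all choices of signs. -/
noncomputable def signExp {ι : Type*} [Fintype ι] [DecidableEq ι] (G : (ι → Bool) → ℝ) : ℝ :=
  prodExp (fun _ _ => 1 / 2) G

section symmetrization
variable {ι κ V : Type*} [Fintype ι] [DecidableEq ι] [Fintype κ] [Nonempty κ] [Fintype V]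

theorem prodExp_prod_bool {w : ι → V → ℝ} (G : (ι → V × Bool) → ℝ) :
    prodExp (fun e z => w e z.1 * (1 / 2)) G =
      prodExp w (fun x => signExp fun ε => G fun e => (x e, ε e)) := by
  simp only [prodExp, signExp]
  rw [← (Equiv.arrowProdEquivProdArrow ι (fun _ => V) (fun _ => Bool)).symm.sum_comp,
    Fintype.sum_prod_type]
  refine Finset.sum_congr rfl fun x _ => ?_
  rw [Finset.mul_sum]
  refine Finset.sum_congr rfl fun ε _ => ?_
  simp only [Equiv.arrowProdEquivProdArrow_symm_apply, Finset.prod_mul_distrib, mul_assoc]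
  rfl

theorem sum_bool_half {w : V → ℝ} (G : V × Bool → ℝ) :
    ∑ z : V × Bool, w z.1 * (1 / 2) * G z = ∑ v, w v * ((G (v, true) + G (v, false)) / 2) := by
  rw [Fintype.sum_prod_type]
  refine Finset.sum_congr rfl fun v _ => ?_
  rw [Fintype.sum_bool]
  ring

theorem signExp_const (c : ℝ) : signExp (fun _ : ι → Bool => c) = c :=
  prodExp_const (fun _ => by norm_num) c

/-- Symmetrization and contraction: a convex increasing function of the maximum of a centred sum of
independent functions `l e` is dominated in expectation by the same function of the maximum of a
Rademacher sum, in which `l` may be replaced by any `s` with larger values and increments. -/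
theorem prodExp_maxEntry_le {F : ℝ → ℝ} (hF : ConvexOn ℝ Set.univ F) (hm : Monotone F)
    {w : ι → V → ℝ} (hw : ∀ e v, 0 ≤ w e v) (hw1 : ∀ e, ∑ v, w e v = 1)
    (l s : ι → V → κ → ℝ) (hls : ∀ e v t, |l e v t| ≤ |s e v t|)
    (hls' : ∀ e v t u, |l e v t - l e v u| ≤ |s e v t - s e v u|) :
    prodExp w (fun x => F (maxEntry fun t => ∑ e, (l e (x e) t - ∑ v, w e v * l e v t))) ≤
      prodExp w (fun x => signExp fun ε =>
        F (maxEntry fun t => ∑ e, 2 * (boolSign (ε e) * s e (x e) t))) := by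
  set W : ι → V × Bool → ℝ := fun e z => w e z.1 * (1 / 2) with hW
  have hW0 : ∀ e z, 0 ≤ W e z := fun e z => mul_nonneg (hw _ _) (by norm_num)
  have hW1 : ∀ e, ∑ z, W e z = 1 := by
    intro e
    have := sum_bool_half (w := w e) (fun _ => 1)
    simp only [mul_one, add_self_div_two, hw1] at this
    exact this
  -- the coordinates in `S` have already been replaced
  set G : Finset ι → (ι → V × Bool) → ℝ := fun S z => F (maxEntry fun t =>
    ∑ e, if e ∈ S then 2 * (boolSign (z e).2 * s e (z e).1 t)
      else l e (z e).1 t - ∑ v, w e v * l e v t) with hG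
  have key : ∀ S : Finset ι, prodExp W (G ∅) ≤ prodExp W (G S) := by
    intro S
    induction S using Finset.induction_on with
    | empty => rfl
    | insert i S hi ih =>
      refine ih.trans ?_
      rw [prodExp_eq_prodExp_update hW1 i (G S), prodExp_eq_prodExp_update hW1 i (G (insert i S))]
      refine prodExp_mono hW0 fun z => ?_
      simp only [hW]
      rw [sum_bool_half, sum_bool_half]
      set a : κ → ℝ := fun t => ∑ e ∈ Finset.univ.erase i,
        if e ∈ S then 2 * (boolSign (z e).2 * s e (z e).1 t)
        else l e (z e).1 t - ∑ v, w e v * l e v t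
      have h1 : ∀ v b, G S (Function.update z i (v, b)) =
          F (maxEntry fun t => a t + (l i v t - ∑ v', w i v' * l i v' t)) := by
        intro v b
        simp only [hG]
        congr 2
        ext t
        rw [← Finset.sum_erase_add _ _ (Finset.mem_univ i)]
        congr 1
        · refine Finset.sum_congr rfl fun e he => ?_
          simp [Finset.ne_of_mem_erase he]
        · simp [hi]
      have h2 : ∀ v b, G (insert i S) (Function.update z i (v, b)) =
          F (maxEntry fun t => a t + 2 * (boolSign b * s i v t)) := by
        intro v b
        simp only [hG]
        congr 2
        ext t
        rw [← Finset.sum_erase_add _ _ (Finset.mem_univ i)]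
        congr 1
        · refine Finset.sum_congr rfl fun e he => ?_
          simp [Finset.ne_of_mem_erase he]
        · simp
      simp only [h1, h2, add_self_div_two]
      refine (symmetrization_step (convexOn_comp_maxEntry hF hm) (hw i) (hw1 i) a (l i)).trans ?_
      refine Finset.sum_le_sum fun v _ => mul_le_mul_of_nonneg_left ?_ (hw i v)
      have h3 := contraction_step hF hm a (fun t => 2 * l i v t) (fun t => 2 * s i v t)
        (fun t => by
          simp only [abs_mul]
          exact mul_le_mul_of_nonneg_left (hls i v t) (abs_nonneg _))
        (fun t u => by
          simp only [← mul_sub, abs_mul]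
          exact mul_le_mul_of_nonneg_left (hls' i v t u) (abs_nonneg _))
      simp only [boolSign, if_true, Bool.false_eq_true, if_false, one_mul, neg_one_mul, mul_neg,
        ← sub_eq_add_neg]
      linarith
  have h := key Finset.univ
  simp only [hW, prodExp_prod_bool] at h
  simpa [hG, signExp_const] using h

end symmetrization

/-! ### Spectral norms, traces and closed walks -/

theorem IsSelfAdjoint.norm_pow_le_norm_pow {A : Type*} [NormedRing A] [StarRing A] [CStarRing A]
    {a : A} (ha : IsSelfAdjoint a) {l : ℕ} (hl : l ≠ 0) : ‖a‖ ^ l ≤ ‖a ^ l‖ := by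
  rcases (norm_nonneg a).eq_or_lt with h0 | h0
  · rw [← h0, zero_pow hl]; exact norm_nonneg _
  have hle : l ≤ 2 ^ l := Nat.lt_two_pow_self.le
  rcases hle.eq_or_lt with he | hlt
  · have := ha.norm_pow_two_pow l
    rw [← he] at this
    exact this.ge
  have h1 : ‖a‖ ^ l * ‖a‖ ^ (2 ^ l - l) ≤ ‖a ^ l‖ * ‖a‖ ^ (2 ^ l - l) := by
    rw [← pow_add, Nat.add_sub_cancel' hle, ← ha.norm_pow_two_pow l]
    calc ‖a ^ 2 ^ l‖ = ‖a ^ l * a ^ (2 ^ l - l)‖ := by rw [← pow_add, Nat.add_sub_cancel' hle]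
      _ ≤ ‖a ^ l‖ * ‖a ^ (2 ^ l - l)‖ := norm_mul_le _ _
      _ ≤ _ := mul_le_mul_of_nonneg_left (norm_pow_le' _ (by omega)) (norm_nonneg _)
  exact le_of_mul_le_mul_right h1 (pow_pos h0 _)

section opNorm
variable {n : ℕ}

/-- The spectral norm of a matrix is at most its Frobenius norm. -/
theorem norm_toEuclideanCLM_sq_le (B : Matrix (Fin n) (Fin n) ℝ) :
    ‖Matrix.toEuclideanCLM (𝕜 := ℝ) B‖ ^ 2 ≤ ∑ i, ∑ j, B i j ^ 2 := by
  have h0 : 0 ≤ ∑ i, ∑ j, B i j ^ 2 :=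
    Finset.sum_nonneg fun i _ => Finset.sum_nonneg fun j _ => sq_nonneg _
  rw [← Real.sq_sqrt h0]
  refine pow_le_pow_left₀ (norm_nonneg _) ?_ 2
  refine ContinuousLinearMap.opNorm_le_bound _ (Real.sqrt_nonneg _) fun x => ?_
  refine (sq_le_sq₀ (norm_nonneg _) (by positivity)).mp ?_
  rw [mul_pow, Real.sq_sqrt h0, EuclideanSpace.norm_sq_eq, EuclideanSpace.norm_sq_eq,
    Finset.sum_mul]
  refine Finset.sum_le_sum fun i _ => ?_
  have := Finset.sum_mul_sq_le_sq_mul_sq Finset.univ (fun j => B i j) (fun j => x j)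
  simpa [Matrix.mulVec, dotProduct] using this

theorem toEuclideanCLM_transpose (X : Matrix (Fin n) (Fin n) ℝ) :
    Matrix.toEuclideanCLM (𝕜 := ℝ) X.transpose = star (Matrix.toEuclideanCLM (𝕜 := ℝ) X) := by
  rw [← map_star, Matrix.star_eq_conjTranspose, Matrix.conjTranspose_eq_transpose_of_trivial]

/-- The spectral norm is bounded by traces of even powers of `X Xᵀ`, as the Frobenius norm of
`(X Xᵀ) ^ l` dominates its spectral norm. -/
theorem norm_pow_le_trace (X : Matrix (Fin n) (Fin n) ℝ) {l : ℕ} (hl : l ≠ 0) :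
    ‖Matrix.toEuclideanCLM (𝕜 := ℝ) X‖ ^ (2 * (2 * l)) ≤
      ((X * X.transpose) ^ (2 * l)).trace := by
  set A := X * X.transpose
  have hA : A.transpose = A := by simp [A]
  have hsa : IsSelfAdjoint (Matrix.toEuclideanCLM (𝕜 := ℝ) A) := by
    rw [IsSelfAdjoint, ← toEuclideanCLM_transpose, hA]
  have h1 : ‖Matrix.toEuclideanCLM (𝕜 := ℝ) X‖ ^ 2 = ‖Matrix.toEuclideanCLM (𝕜 := ℝ) A‖ := by
    rw [map_mul, toEuclideanCLM_transpose, sq]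
    exact CStarRing.norm_self_mul_star.symm
  have h2 : ((A ^ (2 * l)).trace) = ∑ i, ∑ j, (A ^ l) i j ^ 2 := by
    have ht : (A ^ l).transpose = A ^ l := by rw [Matrix.transpose_pow, hA]
    rw [two_mul, pow_add]
    refine Finset.sum_congr rfl fun i _ => ?_
    rw [Matrix.diag_apply, Matrix.mul_apply]
    refine Finset.sum_congr rfl fun j _ => ?_
    have hji : (A ^ l) j i = (A ^ l) i j := congrFun (congrFun ht i) j
    rw [sq, hji]
  rw [h2, pow_mul, h1, mul_comm, pow_mul]
  refine (pow_le_pow_left₀ (by positivity) (hsa.norm_pow_le_norm_pow hl) 2).trans ?_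
  rw [← map_pow]
  exact norm_toEuclideanCLM_sq_le _

theorem trace_le_norm_pow (X : Matrix (Fin n) (Fin n) ℝ) (k : ℕ) (hn : n ≠ 0) :
    ((X * X.transpose) ^ k).trace ≤ n * ‖Matrix.toEuclideanCLM (𝕜 := ℝ) X‖ ^ (2 * k) := by
  have : Nonempty (Fin n) := ⟨⟨0, Nat.pos_of_ne_zero hn⟩⟩
  have h1 : ∀ (B : Matrix (Fin n) (Fin n) ℝ) i, B i i ≤ ‖Matrix.toEuclideanCLM (𝕜 := ℝ) B‖ := by
    intro B i
    have h := (Matrix.toEuclideanCLM (𝕜 := ℝ) B).le_opNorm (EuclideanSpace.single i 1)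
    have h' := PiLp.norm_apply_le (Matrix.toEuclideanCLM (𝕜 := ℝ) B (EuclideanSpace.single i 1)) i
    rw [PiLp.norm_single, norm_one, mul_one] at h
    refine le_trans ?_ (h'.trans h)
    simp [le_abs_self]
  have h2 : ‖Matrix.toEuclideanCLM (𝕜 := ℝ) ((X * X.transpose) ^ k)‖ ≤
      ‖Matrix.toEuclideanCLM (𝕜 := ℝ) X‖ ^ (2 * k) := by
    rw [map_pow, map_mul, toEuclideanCLM_transpose, pow_mul, sq, ← CStarRing.norm_self_mul_star]
    exact norm_pow_le _ _
  calc ((X * X.transpose) ^ k).trace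
      ≤ ∑ _i : Fin n, ‖Matrix.toEuclideanCLM (𝕜 := ℝ) X‖ ^ (2 * k) :=
        Finset.sum_le_sum fun i _ => (h1 _ i).trans h2
    _ = _ := by simp

end opNorm

section walks

/-- The edges of the walk `f 0, j 0, f 1, j 1, …, f k` in a complete bipartite graph, which
alternates between rows `f t` and columns `j t`; an edge is a pair (row, column). -/
def walkEdge {α β : Type*} {k : ℕ} (f : Fin (k + 1) → α) (j : Fin k → β) :
    Fin k ⊕ Fin k → α × β :=
  Sum.elim (fun t => (f t.castSucc, j t)) (fun t => (f t.succ, j t))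

theorem pow_apply_eq_sum_walks {n : ℕ} (A : Matrix (Fin n) (Fin n) ℝ) (k : ℕ) (a b : Fin n) :
    (A ^ k) a b = ∑ f : Fin (k + 1) → Fin n,
      if f 0 = a ∧ f (Fin.last k) = b then ∏ t : Fin k, A (f t.castSucc) (f t.succ) else 0 := by
  induction k generalizing a with
  | zero =>
    rw [← (Equiv.funUnique (Fin 1) (Fin n)).symm.sum_comp]
    simp [Matrix.one_apply, ite_and, Fin.last]
  | succ k ih =>
    rw [pow_succ', Matrix.mul_apply, ← (Fin.consEquiv fun _ => Fin n).sum_comp,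
      Fintype.sum_prod_type_right]
    simp only [ih, Finset.mul_sum]
    rw [Finset.sum_comm]
    refine Finset.sum_congr rfl fun f _ => ?_
    rw [Finset.sum_eq_single (f 0), Finset.sum_eq_single a]
    · simp only [Fin.consEquiv_apply, Fin.cons_zero, true_and, ← Fin.succ_last, Fin.cons_succ,
        Fin.prod_univ_succ (n := k), Fin.castSucc_zero, ← Fin.succ_castSucc, mul_ite, mul_zero]
    · intro c _ hc
      simp [hc]
    · simp
    · intro c _ hc
      simp [hc.symm]
    · simp

theorem trace_pow_eq_sum_walks {n : ℕ} (X : Matrix (Fin n) (Fin n) ℝ) (k : ℕ) :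
    ((X * X.transpose) ^ k).trace = ∑ f : Fin (k + 1) → Fin n, ∑ j : Fin k → Fin n,
      if f 0 = f (Fin.last k) then ∏ s, X (walkEdge f j s).1 (walkEdge f j s).2 else 0 := by
  simp only [Matrix.trace, Matrix.diag_apply, pow_apply_eq_sum_walks]
  rw [Finset.sum_comm]
  refine Finset.sum_congr rfl fun f _ => ?_
  rw [Finset.sum_eq_single (f 0)]
  · by_cases h : f 0 = f (Fin.last k)
    · simp only [true_and, if_pos h.symm, if_pos h, Matrix.mul_apply, Matrix.transpose_apply,
        Fintype.prod_sum_type, walkEdge, Sum.elim_inl, Sum.elim_inr, ← Finset.prod_mul_distrib]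
      rw [Finset.prod_univ_sum, Fintype.piFinset_univ]
    · simp [h, Ne.symm h]
  · intro c _ hc
    simp [Ne.symm hc]
  · simp

/-- The walk is connected, so it has at most one more vertex than it has edges. -/
theorem card_rows_add_card_cols_le {α β : Type*} [DecidableEq α] [DecidableEq β] {k : ℕ}
    (f : Fin (k + 1) → α) (j : Fin k → β) :
    (Finset.univ.image f).card + (Finset.univ.image j).card ≤
      (Finset.univ.image (walkEdge f j)).card + 1 := by
  induction k with
  | zero => simp
  | succ k ih =>
    have h := ih (fun t => f t.castSucc) (fun t => j t.castSucc)
    set R := Finset.univ.image fun t : Fin (k + 1) => f t.castSucc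
    set K := Finset.univ.image fun t : Fin k => j t.castSucc
    set E := Finset.univ.image (walkEdge (fun t : Fin (k + 1) => f t.castSucc)
      (fun t : Fin k => j t.castSucc)) with hE
    set r := f (Fin.last (k + 1))
    set c := j (Fin.last k)
    set r' := f (Fin.last k).castSucc
    have hR : Finset.univ.image f = insert r R := by
      ext x; simp [R, r, Fin.exists_fin_succ', eq_comm, or_comm]
    have hK : Finset.univ.image j = insert c K := by
      ext x; simp [K, c, Fin.exists_fin_succ', eq_comm, or_comm]
    have hEE : Finset.univ.image (walkEdge f j) = insert (r', c) (insert (r, c) E) := by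
      ext x
      simp only [hE, Finset.mem_image, Finset.mem_univ, true_and, Sum.exists, walkEdge,
        Sum.elim_inl, Sum.elim_inr, Fin.exists_fin_succ' (n := k), Finset.mem_insert, r, c, r',
        Fin.succ_castSucc, Fin.succ_last]
      simp only [eq_comm (b := x)]
      tauto
    have hEfst : ∀ x ∈ E, x.1 ∈ R := by
      intro x hx
      simp only [hE, Finset.mem_image, Finset.mem_univ, true_and] at hx
      obtain ⟨s | s, rfl⟩ := hx
      · exact Finset.mem_image_of_mem (fun t : Fin (k + 1) => f t.castSucc) (Finset.mem_univ _)
      · exact Finset.mem_image_of_mem (fun t : Fin (k + 1) => f t.castSucc) (Finset.mem_univ _)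
    have hEsnd : ∀ x ∈ E, x.2 ∈ K := by
      intro x hx
      simp only [hE, Finset.mem_image, Finset.mem_univ, true_and] at hx
      obtain ⟨s | s, rfl⟩ := hx
      · exact Finset.mem_image_of_mem (fun t : Fin k => j t.castSucc) (Finset.mem_univ _)
      · exact Finset.mem_image_of_mem (fun t : Fin k => j t.castSucc) (Finset.mem_univ _)
    have hr' : r' ∈ R :=
      Finset.mem_image_of_mem (fun t : Fin (k + 1) => f t.castSucc) (Finset.mem_univ (Fin.last k))
    rw [hR, hK, hEE]
    by_cases h1 : r ∈ R <;> by_cases h2 : c ∈ K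
    · rw [Finset.insert_eq_of_mem h1, Finset.insert_eq_of_mem h2]
      have := Finset.card_le_card
        ((Finset.subset_insert (r, c) E).trans (Finset.subset_insert (r', c) _))
      omega
    · have h3 : (r, c) ∉ E := fun h => h2 (hEsnd _ h)
      rw [Finset.insert_eq_of_mem h1, Finset.card_insert_of_notMem h2]
      have := Finset.card_le_card (Finset.subset_insert (r', c) (insert (r, c) E))
      rw [Finset.card_insert_of_notMem h3] at this
      omega
    · have h3 : (r, c) ∉ E := fun h => h1 (hEfst _ h)
      rw [Finset.insert_eq_of_mem h2, Finset.card_insert_of_notMem h1]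
      have := Finset.card_le_card (Finset.subset_insert (r', c) (insert (r, c) E))
      rw [Finset.card_insert_of_notMem h3] at this
      omega
    · have h3 : (r, c) ∉ E := fun h => h1 (hEfst _ h)
      have h4 : (r', c) ∉ insert (r, c) E := by
        rw [Finset.mem_insert, not_or]
        refine ⟨fun h => h1 ?_, fun h => h2 (hEsnd _ h)⟩
        have h5 : r' = r := (Prod.ext_iff.mp h).1
        exact h5 ▸ hr'
      rw [Finset.card_insert_of_notMem h1, Finset.card_insert_of_notMem h2,
        Finset.card_insert_of_notMem h4, Finset.card_insert_of_notMem h3]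
      omega

/-- A Rademacher monomial has expectation `1` if every variable occurs in it with even multiplicity,
and expectation `0` otherwise. -/
theorem signExp_prod {ι S : Type*} [Fintype ι] [DecidableEq ι] [Fintype S] (φ : S → ι) :
    signExp (fun ε => ∏ s, boolSign (ε (φ s))) =
      if ∀ s, Even (Finset.univ.filter fun s' => φ s' = φ s).card then 1 else 0 := by
  have h1 : ∀ ε : ι → Bool, ∏ s, boolSign (ε (φ s)) =
      ∏ e, boolSign (ε e) ^ (Finset.univ.filter fun s' => φ s' = e).card := by
    intro ε
    rw [← Finset.prod_fiberwise_of_maps_to (g := φ) (t := Finset.univ) fun _ _ => Finset.mem_univ _]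
    refine Finset.prod_congr rfl fun e _ => ?_
    rw [Finset.prod_congr rfl (g := fun _ => boolSign (ε e)), Finset.prod_const]
    intro s hs
    rw [(Finset.mem_filter.mp hs).2]
  have h2 : ∀ m : ℕ, ∑ b : Bool, (1 / 2 : ℝ) * boolSign b ^ m = if Even m then 1 else 0 := by
    intro m
    rw [Fintype.sum_bool]
    rcases Nat.even_or_odd m with h | h
    · simp [boolSign, h, h.neg_one_pow]; norm_num
    · simp [boolSign, h.neg_one_pow, Nat.not_even_iff_odd.mpr h]
  simp only [h1, signExp]
  rw [prodExp_prod fun e b => boolSign b ^ (Finset.univ.filter fun s' => φ s' = e).card]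
  simp only [h2]
  split_ifs with h
  · refine Finset.prod_eq_one fun e _ => if_pos ?_
    by_cases he : ∃ s, φ s = e
    · obtain ⟨s, rfl⟩ := he
      exact h s
    · have : (Finset.univ.filter fun s' => φ s' = e) = ∅ := by
        simpa [Finset.filter_eq_empty_iff] using he
      simp [this]
  · push Not at h
    obtain ⟨s, hs⟩ := h
    exact Finset.prod_eq_zero (Finset.mem_univ (φ s)) (if_neg hs)

/-- A monomial in independent variables with values in `[0, 1]` is at most the product of its
distinct variables, so its expectation decays with the number of these. -/
theorem prodExp_prod_le {ι V S : Type*} [Fintype ι] [DecidableEq ι] [Fintype V] [Fintype S]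
    {w : ι → V → ℝ} (hw : ∀ e v, 0 ≤ w e v) (hw1 : ∀ e, ∑ v, w e v = 1) {N : ι → V → ℝ}
    (hN0 : ∀ e v, 0 ≤ N e v) (hN1 : ∀ e v, N e v ≤ 1) {q : ℝ} (hq : ∀ e, ∑ v, w e v * N e v ≤ q)
    (φ : S → ι) :
    prodExp w (fun x => ∏ s, N (φ s) (x (φ s))) ≤ q ^ (Finset.univ.image φ).card := by
  have h1 : ∀ x : ι → V, ∏ s, N (φ s) (x (φ s)) ≤
      ∏ e, if e ∈ Finset.univ.image φ then N e (x e) else 1 := by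
    intro x
    rw [Finset.prod_comp (fun e => N e (x e)) φ, Finset.prod_ite_mem, Finset.univ_inter]
    refine Finset.prod_le_prod (fun e _ => pow_nonneg (hN0 _ _) _) fun e he => ?_
    refine pow_le_of_le_one (hN0 _ _) (hN1 _ _) ?_
    obtain ⟨s, -, rfl⟩ := Finset.mem_image.mp he
    exact Finset.card_ne_zero_of_mem (Finset.mem_filter.mpr ⟨Finset.mem_univ s, rfl⟩)
  refine (prodExp_mono hw h1).trans ?_
  rw [prodExp_prod (fun e v => if e ∈ Finset.univ.image φ then N e v else 1)]
  have h2 : ∀ e, ∑ v, w e v * (if e ∈ Finset.univ.image φ then N e v else 1) ≤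
      if e ∈ Finset.univ.image φ then q else 1 := by
    intro e
    split_ifs
    · exact hq e
    · simp [hw1]
  refine (Finset.prod_le_prod (fun e _ => Finset.sum_nonneg fun v _ => mul_nonneg (hw _ _) ?_)
    fun e _ => h2 e).trans ?_
  · split_ifs
    · exact hN0 _ _
    · exact zero_le_one
  · rw [Finset.prod_ite_mem, Finset.univ_inter, Finset.prod_const]

end walks

/-! ### Nets and matrices of random signs -/

section net

/-- A finite set at distance at most `1` from every point of the ball of radius `2`. -/
theorem exists_net (r : ℕ) : ∃ s : Finset (EuclideanSpace ℝ (Fin r)), s.card ≤ 5 ^ r ∧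
    (∀ x ∈ s, ‖x‖ ≤ 2) ∧ ∀ x, ‖x‖ ≤ 2 → ∃ y ∈ s, ‖x - y‖ ≤ 1 := by
  classical
  set P : ℕ → Prop := fun m => ∃ s : Finset (EuclideanSpace ℝ (Fin r)), s.card = m ∧
    (∀ x ∈ s, ‖x‖ ≤ 2) ∧ ∀ x ∈ s, ∀ y ∈ s, x ≠ y → 1 ≤ ‖x - y‖
  have hP : ∀ m, P m → m ≤ 5 ^ r := by
    rintro m ⟨s, rfl, h1, h2⟩
    simpa using Besicovitch.card_le_of_separated s h1 h2
  obtain ⟨s, hs, h1, h2⟩ : P (Nat.findGreatest P (5 ^ r)) :=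
    Nat.findGreatest_spec (m := 0) (Nat.zero_le _) ⟨∅, by simp⟩
  refine ⟨s, hs ▸ Nat.findGreatest_le _, h1, fun x hx => ?_⟩
  -- a separated set of maximal cardinality is a net
  by_contra! hcon
  have hxs : x ∉ s := fun h => by
    have := hcon x h
    rw [sub_self, norm_zero] at this
    linarith
  have hP1 : P (s.card + 1) := by
    refine ⟨insert x s, Finset.card_insert_of_notMem hxs, ?_, ?_⟩
    · intro y hy
      rcases Finset.mem_insert.mp hy with rfl | hy
      exacts [hx, h1 y hy]
    · intro y hy z hz hyz
      rcases Finset.mem_insert.mp hy with hy' | hy' <;>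
        rcases Finset.mem_insert.mp hz with hz' | hz'
      · exact absurd (hy'.trans hz'.symm) hyz
      · exact hy' ▸ (hcon z hz').le
      · rw [norm_sub_rev]; exact hz' ▸ (hcon y hy').le
      · exact h2 y hy' z hz' hyz
  have := Nat.le_findGreatest (hP _ hP1) hP1
  omega

/-- The bilinear form of an operator is at least the operator norm at some pair of points of a net of
the ball of radius `2`. -/
theorem exists_norm_le_inner {r : ℕ} {s : Finset (EuclideanSpace ℝ (Fin r))}
    (hs : ∀ x : EuclideanSpace ℝ (Fin r), ‖x‖ ≤ 2 → ∃ y ∈ s, ‖x - y‖ ≤ 1)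
    (A : EuclideanSpace ℝ (Fin r) →L[ℝ] EuclideanSpace ℝ (Fin r)) :
    ∃ y ∈ s, ∃ z ∈ s, ‖A‖ ≤ inner ℝ y (A z) := by
  have h1 : ∀ v : EuclideanSpace ℝ (Fin r), ∃ y ∈ s, ‖v‖ ≤ inner ℝ y v := by
    intro v
    rcases eq_or_ne v 0 with rfl | hv
    · obtain ⟨y, hy, -⟩ := hs 0 (by simp)
      exact ⟨y, hy, by simp⟩
    have hv' : ‖v‖ ≠ 0 := norm_ne_zero_iff.mpr hv
    obtain ⟨y, hy, hxy⟩ := hs ((2 / ‖v‖) • v) (by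
      rw [norm_smul, norm_div, norm_norm, div_mul_cancel₀ _ hv']; simp)
    refine ⟨y, hy, ?_⟩
    have h2 := (real_inner_le_norm ((2 / ‖v‖) • v - y) v).trans
      (mul_le_mul_of_nonneg_right hxy (norm_nonneg v))
    rw [inner_sub_left, real_inner_smul_left, real_inner_self_eq_norm_sq] at h2
    have h3 : 2 / ‖v‖ * ‖v‖ ^ 2 = 2 * ‖v‖ := by field_simp
    linarith
  obtain ⟨y₀, hy₀, -⟩ := hs 0 (by simp)
  obtain ⟨z, hz, hmax⟩ := s.exists_max_image (fun z => ‖A z‖) ⟨y₀, hy₀⟩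
  obtain ⟨y, hy, hyz⟩ := h1 (A z)
  refine ⟨y, hy, z, hz, le_trans ?_ hyz⟩
  have h2 : ‖A‖ ≤ (‖A z‖ + ‖A‖) / 2 := by
    refine ContinuousLinearMap.opNorm_le_bound _ (by positivity) fun x => ?_
    rcases eq_or_ne x 0 with rfl | hx
    · simp
    have hx' : 0 < ‖x‖ := norm_pos_iff.mpr hx
    obtain ⟨t, ht, hxt⟩ := hs ((2 / ‖x‖) • x) (by
      rw [norm_smul, norm_div, norm_norm, div_mul_cancel₀ _ hx'.ne']; simp)
    have h3 : ‖A ((2 / ‖x‖) • x)‖ ≤ ‖A z‖ + ‖A‖ := by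
      calc ‖A ((2 / ‖x‖) • x)‖ = ‖A t + A ((2 / ‖x‖) • x - t)‖ := by
            rw [← map_add, add_sub_cancel]
        _ ≤ ‖A t‖ + ‖A‖ * ‖(2 / ‖x‖) • x - t‖ := (norm_add_le _ _).trans
            (add_le_add_right (A.le_opNorm _) _)
        _ ≤ ‖A z‖ + ‖A‖ := add_le_add (hmax t ht) (mul_le_of_le_one_right (norm_nonneg _) hxt)
    rw [map_smul, norm_smul, norm_div, norm_norm, Real.norm_ofNat, div_mul_eq_mul_div,
      div_le_iff₀ hx'] at h3
    linarith
  linarith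

end net

section signMatrix

/-- The square matrix of signs encoded by `ε`. -/
def signMatrix {r : ℕ} (ε : Fin r × Fin r → Bool) : Matrix (Fin r) (Fin r) ℝ :=
  Matrix.of fun i j => boolSign (ε (i, j))

theorem signExp_mono {ι : Type*} [Fintype ι] [DecidableEq ι] {G H : (ι → Bool) → ℝ}
    (h : ∀ ε, G ε ≤ H ε) : signExp G ≤ signExp H :=
  prodExp_mono (fun _ _ => by norm_num) h

theorem signExp_sum {ι κ : Type*} [Fintype ι] [DecidableEq ι] (s : Finset κ)
    (G : κ → (ι → Bool) → ℝ) :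
    signExp (fun ε => ∑ t ∈ s, G t ε) = ∑ t ∈ s, signExp (G t) :=
  prodExp_sum s G

theorem signExp_exp_le {ι : Type*} [Fintype ι] [DecidableEq ι] (a : ι → ℝ) :
    signExp (fun ε => Real.exp (∑ e, a e * boolSign (ε e))) ≤ Real.exp ((∑ e, a e ^ 2) / 2) := by
  simp only [Real.exp_sum, signExp]
  rw [prodExp_prod fun e b => Real.exp (a e * boolSign b), Finset.sum_div, Real.exp_sum]
  refine Finset.prod_le_prod (fun e _ => Finset.sum_nonneg fun b _ => by positivity) fun e _ => ?_
  refine le_trans (le_of_eq ?_) (Real.cosh_le_exp_half_sq (a e))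
  rw [Fintype.sum_bool, Real.cosh_eq]
  simp [boolSign]
  ring

/-- An even moment of a Rademacher sum, estimated by the Laplace transform. -/
theorem signExp_sum_pow_le {ι : Type*} [Fintype ι] [DecidableEq ι] (a : ι → ℝ)
    (ha : ∑ e, a e ^ 2 ≤ 16) (k : ℕ) (hk : k ≠ 0) :
    signExp (fun ε => (∑ e, a e * boolSign (ε e)) ^ (2 * k)) ≤
      2 * (4 * Real.exp 8 * k) ^ k := by
  have hk0 : (0 : ℝ) < k := by exact_mod_cast Nat.pos_of_ne_zero hk
  have h1 : ∀ c : ℝ, c ^ 2 = k → signExp (fun ε => Real.exp (∑ e, c * a e * boolSign (ε e))) ≤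
      Real.exp 8 ^ k := by
    intro c hc
    refine (signExp_exp_le fun e => c * a e).trans ?_
    rw [← Real.exp_nat_mul, Real.exp_le_exp]
    simp only [mul_pow, hc, ← Finset.mul_sum]
    nlinarith
  have hs : √(k : ℝ) ^ 2 = k := Real.sq_sqrt hk0.le
  have h2 : ∀ ε : ι → Bool, (k : ℝ) ^ k * (∑ e, a e * boolSign (ε e)) ^ (2 * k) ≤
      ((2 * k : ℕ) : ℝ) ^ (2 * k) * (Real.exp (∑ e, √k * a e * boolSign (ε e)) +
        Real.exp (∑ e, -√k * a e * boolSign (ε e))) := by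
    intro ε
    have e1 : ∑ e, √k * a e * boolSign (ε e) = √k * ∑ e, a e * boolSign (ε e) := by
      simp only [Finset.mul_sum, mul_assoc]
    have e2 : ∑ e, -√k * a e * boolSign (ε e) = -(√k * ∑ e, a e * boolSign (ε e)) := by
      simp only [Finset.mul_sum, mul_assoc, neg_mul, Finset.sum_neg_distrib]
    rw [e1, e2]
    set x := √k * ∑ e, a e * boolSign (ε e) with hx
    have e3 : (k : ℝ) ^ k * (∑ e, a e * boolSign (ε e)) ^ (2 * k) = |x| ^ (2 * k) := by
      rw [Even.pow_abs (even_two_mul k), hx, mul_pow, pow_mul √(k : ℝ), hs]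
    have e4 := Real.pow_div_factorial_le_exp |x| (abs_nonneg x) (2 * k)
    rw [div_le_iff₀ (by positivity)] at e4
    have e5 : Real.exp |x| ≤ Real.exp x + Real.exp (-x) := by
      rcases abs_cases x with ⟨h, -⟩ | ⟨h, -⟩ <;> rw [h] <;>
        linarith [Real.exp_pos x, Real.exp_pos (-x)]
    have e6 : ((2 * k).factorial : ℝ) ≤ ((2 * k : ℕ) : ℝ) ^ (2 * k) := by
      exact_mod_cast Nat.factorial_le_pow (2 * k)
    rw [e3]
    calc |x| ^ (2 * k) ≤ Real.exp |x| * (2 * k).factorial := e4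
      _ ≤ (Real.exp x + Real.exp (-x)) * ((2 * k : ℕ) : ℝ) ^ (2 * k) := by gcongr
      _ = _ := mul_comm _ _
  have h3 := signExp_mono h2
  have h4 : ∀ (c : ℝ) (G : (ι → Bool) → ℝ), signExp (fun ε => c * G ε) = c * signExp G :=
    fun c G => prodExp_mul_left c G
  have h5 : ∀ G H : (ι → Bool) → ℝ, signExp (fun ε => G ε + H ε) = signExp G + signExp H := by
    intro G H
    simp only [signExp, prodExp, mul_add, Finset.sum_add_distrib]
  rw [h4, h4, h5] at h3
  have h6 := h3.trans (mul_le_mul_of_nonneg_left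
    (add_le_add (h1 √k hs) (h1 (-√k) (by rw [neg_sq, hs]))) (by positivity))
  refine le_of_mul_le_mul_left (h6.trans (le_of_eq ?_)) (pow_pos hk0 k)
  push_cast
  rw [pow_mul (2 * (k : ℝ))]
  simp only [mul_pow]
  norm_num
  ring

theorem inner_signMatrix_apply {r : ℕ} (ε : Fin r × Fin r → Bool)
    (y z : EuclideanSpace ℝ (Fin r)) :
    inner ℝ y (Matrix.toEuclideanCLM (𝕜 := ℝ) (signMatrix ε) z) =
      ∑ e : Fin r × Fin r, y e.1 * z e.2 * boolSign (ε e) := by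
  rw [Fintype.sum_prod_type]
  simp only [PiLp.inner_apply, Matrix.ofLp_toEuclideanCLM, Matrix.mulVec, dotProduct,
    signMatrix, Matrix.of_apply, RCLike.inner_apply, conj_trivial, Finset.sum_mul]
  exact Finset.sum_congr rfl fun i _ => Finset.sum_congr rfl fun j _ => by ring

theorem single_le_sum_sum {α β : Type*} {s : Finset α} {t : Finset β} {g : α → β → ℝ}
    (hg : ∀ y z, 0 ≤ g y z) {y : α} {z : β} (hy : y ∈ s) (hz : z ∈ t) :
    g y z ≤ ∑ y ∈ s, ∑ z ∈ t, g y z :=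
  (Finset.single_le_sum (fun z _ => hg y z) hz).trans
    (Finset.single_le_sum (f := fun y => ∑ z ∈ t, g y z)
      (fun y _ => Finset.sum_nonneg fun z _ => hg y z) hy)

/-- Moments of order `2 k` of the spectral norm of a `2 k × 2 k` matrix of random signs, by a union
bound over a net. -/
theorem signExp_norm_pow_le (k : ℕ) (hk : k ≠ 0) :
    signExp (fun ε : Fin (2 * k) × Fin (2 * k) → Bool =>
      ‖Matrix.toEuclideanCLM (𝕜 := ℝ) (signMatrix ε)‖ ^ (2 * k)) ≤
      2 * (2500 * Real.exp 8 * k) ^ k := by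
  obtain ⟨s, hcard, hs2, hs⟩ := exists_net (2 * k)
  have h1 : ∀ ε : Fin (2 * k) × Fin (2 * k) → Bool,
      ‖Matrix.toEuclideanCLM (𝕜 := ℝ) (signMatrix ε)‖ ^ (2 * k) ≤
      ∑ y ∈ s, ∑ z ∈ s, (∑ e, y e.1 * z e.2 * boolSign (ε e)) ^ (2 * k) := by
    intro ε
    obtain ⟨y, hy, z, hz, hyz⟩ := exists_norm_le_inner hs
      (Matrix.toEuclideanCLM (𝕜 := ℝ) (signMatrix ε))
    rw [inner_signMatrix_apply] at hyz
    have hnn : ∀ c : ℝ, 0 ≤ c ^ (2 * k) := fun c => (even_two_mul k).pow_nonneg c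
    exact (pow_le_pow_left₀ (norm_nonneg _) hyz _).trans (single_le_sum_sum
      (g := fun y z : EuclideanSpace ℝ (Fin (2 * k)) =>
        (∑ e : Fin (2 * k) × Fin (2 * k), y e.1 * z e.2 * boolSign (ε e)) ^ (2 * k))
      (fun y z => hnn _) hy hz)
  refine (signExp_mono h1).trans ?_
  rw [signExp_sum, Finset.sum_congr rfl fun y _ => signExp_sum s _]
  have h2 : ∀ y ∈ s, ∀ z ∈ s, signExp (fun ε =>
      (∑ e : Fin (2 * k) × Fin (2 * k), y e.1 * z e.2 * boolSign (ε e)) ^ (2 * k)) ≤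
      2 * (4 * Real.exp 8 * k) ^ k := by
    intro y hy z hz
    refine signExp_sum_pow_le (fun e : Fin (2 * k) × Fin (2 * k) => y e.1 * z e.2) ?_ k hk
    rw [Fintype.sum_prod_type]
    simp only [mul_pow, ← Finset.mul_sum, ← Finset.sum_mul]
    have e1 : ∀ x : EuclideanSpace ℝ (Fin (2 * k)), ‖x‖ ≤ 2 → ∑ i, x i ^ 2 ≤ 4 := by
      intro x hx
      have := EuclideanSpace.norm_sq_eq x
      simp only [Real.norm_eq_abs, sq_abs] at this
      rw [← this]
      nlinarith [norm_nonneg x]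
    have := mul_le_mul (e1 y (hs2 y hy)) (e1 z (hs2 z hz))
      (Finset.sum_nonneg fun i _ => sq_nonneg _) (by norm_num)
    linarith
  have h3 : (s.card : ℝ) ≤ 25 ^ k := by
    have : (s.card : ℝ) ≤ 5 ^ (2 * k) := by exact_mod_cast hcard
    rw [pow_mul] at this
    norm_num at this
    exact this
  calc _ ≤ ∑ y ∈ s, ∑ z ∈ s, 2 * (4 * Real.exp 8 * k) ^ k :=
        Finset.sum_le_sum fun y hy => Finset.sum_le_sum fun z hz => h2 y hy z hz
    _ = s.card * (s.card * (2 * (4 * Real.exp 8 * k) ^ k)) := by simp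
    _ ≤ 25 ^ k * (25 ^ k * (2 * (4 * Real.exp 8 * k) ^ k)) := by gcongr
    _ = 2 * (2500 * Real.exp 8 * k) ^ k := by
        have e : ∀ c : ℝ, 25 ^ k * (25 ^ k * (2 * c ^ k)) = 2 * (25 * (25 * c)) ^ k := fun c => by
          rw [mul_pow, mul_pow]; ring
        rw [e]
        ring_nf

end signMatrix

/-! ### Comparison of walk counts -/

section shapes

theorem card_ker_eq {A : Type*} [Fintype A] (s : Setoid A) (n : ℕ) :
    Nat.card {f : A → Fin n // Setoid.ker f = s} = n.descFactorial (Nat.card (Quotient s)) := by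
  classical
  have e : {f : A → Fin n // Setoid.ker f = s} ≃ (Quotient s ↪ Fin n) :=
    { toFun := fun f => ⟨Quotient.lift f.1 (fun a b h => by
          have h' : Setoid.ker f.1 a b := by rw [f.2]; exact h
          exact h'), by
        rintro ⟨a⟩ ⟨b⟩ h
        apply Quotient.sound
        have h' : Setoid.ker f.1 a b := h
        rw [f.2] at h'
        exact h'⟩
      invFun := fun g => ⟨fun a => g (Quotient.mk s a), by
        ext a b
        rw [Setoid.ker_def, g.injective.eq_iff, Quotient.eq]⟩
      left_inv := fun f => rfl
      right_inv := fun g => by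
        ext ⟨a⟩
        rfl }
  have : Fintype (Quotient s) := Fintype.ofFinite _
  rw [Nat.card_congr e, Nat.card_eq_fintype_card, Nat.card_eq_fintype_card,
    Fintype.card_embedding_eq, Fintype.card_fin]

instance {A : Type*} [Finite A] : Finite (Setoid A) :=
  Finite.of_injective (fun s : Setoid A => s.r) fun s t h => by
    cases s; cases t; simp_all

/-- A sum over functions whose terms depend only on the coincidences between the values. -/
theorem sum_ker {A : Type*} [Fintype A] [DecidableEq A] [Fintype (Setoid A)] (n : ℕ)
    (H : Setoid A → ℝ) :
    ∑ f : A → Fin n, H (Setoid.ker f) =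
      ∑ s : Setoid A, (n.descFactorial (Nat.card (Quotient s)) : ℝ) * H s := by
  classical
  rw [← Finset.sum_fiberwise_of_maps_to (g := fun f : A → Fin n => Setoid.ker f)
    (t := Finset.univ) fun _ _ => Finset.mem_univ _]
  refine Finset.sum_congr rfl fun s _ => ?_
  rw [Finset.sum_congr rfl (g := fun _ => H s), Finset.sum_const, nsmul_eq_mul]
  · rw [← card_ker_eq s n, Nat.card_eq_fintype_card, Fintype.card_subtype]
  · intro f hf
    rw [(Finset.mem_filter.mp hf).2]

theorem card_image_eq_card_quotient_ker {A B : Type*} [Fintype A] [DecidableEq B] (f : A → B) :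
    (Finset.univ.image f).card = Nat.card (Quotient (Setoid.ker f)) := by
  rw [Nat.card_congr (Setoid.quotientKerEquivRange f), ← Set.ncard_coe_finset, Set.ncard]
  simp [Set.encard, Nat.card]

end shapes

section evenClosed
variable {k : ℕ}

/-- The walk with the coincidence pattern `(S, R)` of its rows and columns is closed and passes
through each of its edges an even number of times. -/
def EvenClosed (S : Setoid (Fin (k + 1))) (R : Setoid (Fin k)) : Prop :=
  S 0 (Fin.last k) ∧ ∀ s, Even (Nat.card {s' //
    S (walkEdge id id s').1 (walkEdge id id s).1 ∧ R (walkEdge id id s').2 (walkEdge id id s).2})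

theorem evenClosed_ker_iff {α β : Type*} [DecidableEq α] [DecidableEq β]
    (f : Fin (k + 1) → α) (j : Fin k → β) :
    EvenClosed (Setoid.ker f) (Setoid.ker j) ↔ f 0 = f (Fin.last k) ∧
      ∀ s, Even (Finset.univ.filter fun s' => walkEdge f j s' = walkEdge f j s).card := by
  have hw : ∀ s, walkEdge f j s = (f (walkEdge id id s).1, j (walkEdge id id s).2) := by
    rintro (s | s) <;> rfl
  refine and_congr Iff.rfl (forall_congr' fun s => ?_)
  rw [← Fintype.card_subtype, ← Nat.card_eq_fintype_card]
  simp only [hw, Prod.mk.injEq, Setoid.ker_def]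

open Classical in
/-- The expected trace counts the closed walks that use every edge an even number of times. -/
theorem signExp_trace_eq (r k : ℕ) :
    signExp (fun ε : Fin r × Fin r → Bool =>
      ((signMatrix ε * (signMatrix ε).transpose) ^ k).trace) =
    ∑ f : Fin (k + 1) → Fin r, ∑ j : Fin k → Fin r,
      if EvenClosed (Setoid.ker f) (Setoid.ker j) then 1 else 0 := by
  simp only [trace_pow_eq_sum_walks]
  rw [signExp_sum]
  refine Finset.sum_congr rfl fun f _ => ?_
  rw [signExp_sum]
  refine Finset.sum_congr rfl fun j _ => ?_
  simp only [evenClosed_ker_iff]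
  by_cases h : f 0 = f (Fin.last k)
  · simp only [h, true_and]
    exact signExp_prod (walkEdge f j)
  · simp only [h, false_and, if_false]
    exact signExp_const 0

open Classical in
/-- Averaging over the signs leaves the even closed walks, each with a factor at most `q` for every
distinct edge. -/
theorem prodExp_signExp_trace_le {n : ℕ} {V : Type*} [Fintype V] {w : Fin n × Fin n → V → ℝ}
    (hw : ∀ e v, 0 ≤ w e v) (hw1 : ∀ e, ∑ v, w e v = 1) {N : Fin n × Fin n → V → ℝ}
    (hN0 : ∀ e v, 0 ≤ N e v) (hN1 : ∀ e v, N e v ≤ 1) {q : ℝ} (hq : ∀ e, ∑ v, w e v * N e v ≤ q)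
    (k : ℕ) :
    prodExp w (fun x => signExp fun ε : Fin n × Fin n → Bool =>
      (((Matrix.of fun i j => boolSign (ε (i, j)) * N (i, j) (x (i, j))) *
        (Matrix.of fun i j => boolSign (ε (i, j)) * N (i, j) (x (i, j))).transpose) ^ k).trace) ≤
    ∑ f : Fin (k + 1) → Fin n, ∑ j : Fin k → Fin n,
      if EvenClosed (Setoid.ker f) (Setoid.ker j) then
        q ^ (Finset.univ.image (walkEdge f j)).card else 0 := by
  simp only [trace_pow_eq_sum_walks, signExp_sum]
  rw [prodExp_sum]
  refine Finset.sum_le_sum fun f _ => ?_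
  rw [prodExp_sum]
  refine Finset.sum_le_sum fun j _ => ?_
  simp only [evenClosed_ker_iff, Matrix.of_apply, Prod.mk.eta]
  by_cases h : f 0 = f (Fin.last k)
  · simp only [h, true_and, Finset.prod_mul_distrib]
    have h1 : ∀ x : Fin n × Fin n → V, signExp (fun ε =>
        (∏ s, boolSign (ε (walkEdge f j s))) *
          ∏ s, N (walkEdge f j s) (x (walkEdge f j s))) =
        (∏ s, N (walkEdge f j s) (x (walkEdge f j s))) *
          if ∀ s, Even (Finset.univ.filter fun s' => walkEdge f j s' = walkEdge f j s).card
          then 1 else 0 := by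
      intro x
      rw [← signExp_prod]
      simp only [mul_comm (∏ s, boolSign _)]
      exact prodExp_mul_left _ _
    refine (prodExp_mono hw fun x => (h1 x).le).trans ?_
    split_ifs
    · simp only [mul_one]
      exact prodExp_prod_le hw hw1 hN0 hN1 hq (walkEdge f j)
    · simp only [mul_zero]
      exact (prodExp_const hw1 0).le
  · simp only [h, false_and, if_false, signExp_const]
    exact (prodExp_const hw1 0).le

/-- Comparison of the number of walks of a given shape on `n` vertices, each weighted with a factor
`q` per edge, and on `2 k` vertices. -/
theorem descFactorial_mul_pow_le {n k a b m : ℕ} {q : ℝ} (hq0 : 0 ≤ q) (hq1 : q ≤ 1)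
    (hk : 1 ≤ k) (hqk : n * q ≤ k) (ha0 : 1 ≤ a) (ha : a ≤ k + 1) (hb : b ≤ k)
    (hm : a + b ≤ m + 1) :
    (n.descFactorial a : ℝ) * ((n.descFactorial b : ℝ) * q ^ m) ≤
      n * (((2 * k).descFactorial a : ℝ) * ((2 * k).descFactorial b : ℝ)) := by
  have hk' : (1 : ℝ) ≤ k := by exact_mod_cast hk
  obtain ⟨c, rfl⟩ : ∃ c, a = c + 1 := ⟨a - 1, by omega⟩
  have h1 : ∀ t, t ≤ k + 1 → (k : ℝ) ^ t ≤ ((2 * k).descFactorial t : ℝ) := by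
    intro t ht
    have h := Nat.pow_sub_le_descFactorial (2 * k) t
    have h' : k ^ t ≤ (2 * k + 1 - t) ^ t := Nat.pow_le_pow_left (by omega) t
    exact_mod_cast h'.trans h
  have h2 : ∀ t, (n.descFactorial t : ℝ) ≤ (n : ℝ) ^ t := fun t => by
    exact_mod_cast Nat.descFactorial_le_pow n t
  calc (n.descFactorial (c + 1) : ℝ) * ((n.descFactorial b : ℝ) * q ^ m)
      ≤ (n : ℝ) ^ (c + 1) * ((n : ℝ) ^ b * q ^ (c + b)) := by
        gcongr ?_ * (?_ * ?_)
        · exact h2 _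
        · exact h2 _
        · exact pow_le_pow_of_le_one hq0 hq1 (by omega)
    _ = n * (n * q) ^ (c + b) := by ring
    _ ≤ n * (k : ℝ) ^ (c + 1 + b) := by
        gcongr
        exact (pow_le_pow_left₀ (by positivity) hqk _).trans (pow_le_pow_right₀ hk' (by omega))
    _ ≤ _ := by
        rw [pow_add]
        gcongr
        · exact h1 _ ha
        · exact h1 _ (by omega)

open Classical in
/-- The walks are grouped by the coincidence patterns of their rows and columns; within a pattern
both the weight and the property of being even and closed are constant. -/
theorem sum_evenClosed_le {n : ℕ} {q : ℝ} (hq0 : 0 ≤ q) (hq1 : q ≤ 1) (hk : 1 ≤ k)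
    (hqk : n * q ≤ k) :
    (∑ f : Fin (k + 1) → Fin n, ∑ j : Fin k → Fin n,
      if EvenClosed (Setoid.ker f) (Setoid.ker j) then
        q ^ (Finset.univ.image (walkEdge f j)).card else 0) ≤
    n * ∑ f : Fin (k + 1) → Fin (2 * k), ∑ j : Fin k → Fin (2 * k),
      if EvenClosed (Setoid.ker f) (Setoid.ker j)
      then 1 else 0 := by
  have : Fintype (Setoid (Fin (k + 1))) := Fintype.ofFinite _
  have : Fintype (Setoid (Fin k)) := Fintype.ofFinite _
  set c : Setoid (Fin (k + 1)) → Setoid (Fin k) → ℝ := fun S R =>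
    if EvenClosed S R then
      q ^ (Nat.card (Quotient S) + Nat.card (Quotient R) - 1) else 0 with hc
  calc _ ≤ ∑ f : Fin (k + 1) → Fin n, ∑ j : Fin k → Fin n, c (Setoid.ker f) (Setoid.ker j) := by
        refine Finset.sum_le_sum fun f _ => Finset.sum_le_sum fun j _ => ?_
        simp only [hc]
        split_ifs
        · refine pow_le_pow_of_le_one hq0 hq1 ?_
          have := card_rows_add_card_cols_le f j
          rw [← card_image_eq_card_quotient_ker, ← card_image_eq_card_quotient_ker]
          omega
        · exact le_rfl
    _ = ∑ S : Setoid (Fin (k + 1)), (n.descFactorial (Nat.card (Quotient S)) : ℝ) *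
          ∑ R : Setoid (Fin k), (n.descFactorial (Nat.card (Quotient R)) : ℝ) * c S R := by
        rw [Finset.sum_congr rfl fun f _ => sum_ker n fun R => c (Setoid.ker f) R]
        exact sum_ker n fun S => ∑ R : Setoid (Fin k),
          (n.descFactorial (Nat.card (Quotient R)) : ℝ) * c S R
    _ ≤ n * ∑ S : Setoid (Fin (k + 1)), ((2 * k).descFactorial (Nat.card (Quotient S)) : ℝ) *
          ∑ R : Setoid (Fin k), ((2 * k).descFactorial (Nat.card (Quotient R)) : ℝ) *
            if EvenClosed S R then 1 else 0 := by
        simp only [Finset.mul_sum]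
        refine Finset.sum_le_sum fun S _ => Finset.sum_le_sum fun R _ => ?_
        simp only [hc]
        split_ifs
        · rw [mul_one]
          refine descFactorial_mul_pow_le hq0 hq1 hk hqk ?_ ?_ ?_ (by omega)
          · exact Nat.card_pos (α := Quotient S)
          · simpa using Nat.card_le_card_of_surjective (Quotient.mk S) Quotient.mk_surjective
          · simpa using Nat.card_le_card_of_surjective (Quotient.mk R) Quotient.mk_surjective
        · simp
    _ = _ := by
        congr 1
        rw [Finset.sum_congr rfl fun f _ =>
          sum_ker (2 * k) fun R => (if EvenClosed (Setoid.ker f) R then (1 : ℝ) else 0)]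
        exact (sum_ker (2 * k) fun S => ∑ R : Setoid (Fin k),
          ((2 * k).descFactorial (Nat.card (Quotient R)) : ℝ) *
            if EvenClosed S R then 1 else 0).symm

/-- The moment of order `2 k` of the spectral norm of a sparse random matrix with independent
symmetric entries: it is of the size of `√k`, as for a dense `k × k` matrix, as soon as `k` is at
least the expected number `n q` of nonzero entries in a row. -/
theorem prodExp_signExp_norm_pow_le {n : ℕ} {V : Type*} [Fintype V] {w : Fin n × Fin n → V → ℝ}
    (hw : ∀ e v, 0 ≤ w e v) (hw1 : ∀ e, ∑ v, w e v = 1) {N : Fin n × Fin n → V → ℝ}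
    (hN0 : ∀ e v, 0 ≤ N e v) (hN1 : ∀ e v, N e v ≤ 1) {q : ℝ} (hq0 : 0 ≤ q) (hq1 : q ≤ 1)
    (hq : ∀ e, ∑ v, w e v * N e v ≤ q) {k : ℕ} (hk : k ≠ 0) (hke : Even k) (hqk : n * q ≤ k) :
    prodExp w (fun x => signExp fun ε : Fin n × Fin n → Bool =>
      ‖Matrix.toEuclideanCLM (𝕜 := ℝ)
        (Matrix.of fun i j => boolSign (ε (i, j)) * N (i, j) (x (i, j)))‖ ^ (2 * k)) ≤
      n * (10000 * Real.exp 8 * k) ^ k := by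
  classical
  obtain ⟨l, rfl⟩ := hke.exists_two_nsmul
  rw [smul_eq_mul] at *
  have h1 : prodExp w (fun x => signExp fun ε : Fin n × Fin n → Bool =>
      ‖Matrix.toEuclideanCLM (𝕜 := ℝ)
        (Matrix.of fun i j => boolSign (ε (i, j)) * N (i, j) (x (i, j)))‖ ^ (2 * (2 * l))) ≤ _ :=
    (prodExp_mono hw fun x => signExp_mono fun ε => norm_pow_le_trace _ (by omega)).trans
      (prodExp_signExp_trace_le hw hw1 hN0 hN1 hq (2 * l))
  refine h1.trans ((sum_evenClosed_le hq0 hq1 (Nat.pos_of_ne_zero hk) hqk).trans ?_)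
  rw [← signExp_trace_eq]
  gcongr
  set k := 2 * l
  have h2 : signExp (fun ε : Fin (2 * k) × Fin (2 * k) → Bool =>
      ((signMatrix ε * (signMatrix ε).transpose) ^ k).trace) ≤
      ((2 * k : ℕ) : ℝ) * (2 * (2500 * Real.exp 8 * k) ^ k) := by
    refine (signExp_mono fun ε => trace_le_norm_pow (signMatrix ε) k (by omega)).trans ?_
    have h3 : signExp (fun ε : Fin (2 * k) × Fin (2 * k) → Bool => ((2 * k : ℕ) : ℝ) *
        ‖Matrix.toEuclideanCLM (𝕜 := ℝ) (signMatrix ε)‖ ^ (2 * k)) = _ := prodExp_mul_left _ _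
    rw [h3]
    gcongr
    exact signExp_norm_pow_le k hk
  refine h2.trans ?_
  have h4 : (4 * k : ℝ) ≤ 4 ^ k := by
    have h5 : k ≤ 4 ^ (k - 1) := by
      have := Nat.lt_pow_self (n := k - 1) (a := 4) (by norm_num)
      omega
    have h6 : 4 * k ≤ 4 ^ k := by
      calc 4 * k ≤ 4 * 4 ^ (k - 1) := by omega
        _ = 4 ^ k := by rw [← pow_succ']; congr 1; omega
    exact_mod_cast h6
  calc ((2 * k : ℕ) : ℝ) * (2 * (2500 * Real.exp 8 * k) ^ k)
      = 4 * k * (2500 * Real.exp 8 * k) ^ k := by push_cast; ring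
    _ ≤ 4 ^ k * (2500 * Real.exp 8 * k) ^ k := by gcongr
    _ = (10000 * Real.exp 8 * k) ^ k := by rw [← mul_pow]; ring_nf

end evenClosed

/-! ### The law of the comparison counts -/

section binomialSums

theorem binomial_real_eq_eval (m k : ℕ) (p : I) :
    (binomial m p).real {k} = (bernsteinPolynomial ℝ m k).eval (p : ℝ) := by
  simp [binomial_real_singleton, bernsteinPolynomial]

theorem sum_range_binomial {m T : ℕ} (hm : m ≤ T) (p : I) (f : ℕ → ℝ) :
    ∑ k ∈ Finset.range (T + 1), (binomial m p).real {k} * f k =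
      ∑ k ∈ Finset.range (m + 1), (binomial m p).real {k} * f k := by
  refine (Finset.sum_subset (Finset.range_mono (by omega)) fun k _ hk => ?_).symm
  rw [binomial_real_singleton, Nat.choose_eq_zero_of_lt (by simpa using hk)]
  simp

theorem sum_binomial_real {m T : ℕ} (hm : m ≤ T) (p : I) :
    ∑ k ∈ Finset.range (T + 1), (binomial m p).real {k} = 1 := by
  have h := sum_range_binomial hm p fun _ => 1
  simp only [mul_one] at h
  rw [h]
  simp only [binomial_real_eq_eval]
  rw [← Polynomial.eval_finsetSum, bernsteinPolynomial.sum, Polynomial.eval_one]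

theorem sum_binomial_real_mul {m T : ℕ} (hm : m ≤ T) (p : I) :
    ∑ k ∈ Finset.range (T + 1), (binomial m p).real {k} * k = m * p := by
  rw [sum_range_binomial hm p fun k => (k : ℝ)]
  have h := congrArg (Polynomial.eval (p : ℝ)) (bernsteinPolynomial.sum_smul ℝ m)
  simp only [Polynomial.eval_finsetSum, nsmul_eq_mul, Polynomial.eval_mul, Polynomial.eval_natCast,
    Polynomial.eval_X] at h
  rw [← h]
  exact Finset.sum_congr rfl fun k _ => by rw [binomial_real_eq_eval, mul_comm]

end binomialSums

section counts
variable {n T : ℕ}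

/-- The number of comparisons recorded in a pair of counts. -/
def numComparisons (v : Fin (T + 1) × Fin (T + 1)) : ℝ := (v.1 : ℕ)

/-- The number of wins recorded in a pair of counts, truncated at the number of comparisons:
this makes the log-likelihood of a pair Lipschitz also at the values of probability zero. -/
def numWins (v : Fin (T + 1) × Fin (T + 1)) : ℝ := (min (v.2 : ℕ) (v.1 : ℕ) : ℕ)

theorem numWins_nonneg (v : Fin (T + 1) × Fin (T + 1)) : 0 ≤ numWins v := Nat.cast_nonneg _

theorem numWins_le (v : Fin (T + 1) × Fin (T + 1)) : numWins v ≤ numComparisons v :=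
  Nat.cast_le.mpr (min_le_right _ _)

theorem numComparisons_nonneg (v : Fin (T + 1) × Fin (T + 1)) : 0 ≤ numComparisons v :=
  Nat.cast_nonneg _

theorem numComparisons_le (v : Fin (T + 1) × Fin (T + 1)) : numComparisons v ≤ T :=
  Nat.cast_le.mpr (Nat.lt_succ_iff.mp v.1.2)

/-- Truncation of a pair of counts to the finite range `{0, …, T}`. -/
def clip (T : ℕ) (c : ℕ × ℕ) : Fin (T + 1) × Fin (T + 1) :=
  (⟨min c.1 T, Nat.lt_succ_iff.mpr (min_le_right _ _)⟩,
    ⟨min c.2 T, Nat.lt_succ_iff.mpr (min_le_right _ _)⟩)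

theorem numComparisons_clip {c : ℕ × ℕ} (h : c.1 ≤ T) : numComparisons (clip T c) = c.1 := by
  simp [numComparisons, clip, h]

theorem numWins_clip {c : ℕ × ℕ} (h : c.1 ≤ T) (h' : c.2 ≤ c.1) :
    numWins (clip T c) = c.2 := by
  simp only [numWins, clip]
  rw [min_eq_left h, min_eq_left (h'.trans h), min_eq_left h']

variable {Ω : Type*}

/-- The family of all counts, indexed by ordered pairs; the pairs `(i, j)` with `j ≤ i`, which carry
no information, get the value `0`. -/
def countFamily (T : ℕ) (N Y : Fin n → Fin n → Ω → ℕ) (ω : Ω) (e : Fin n × Fin n) :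
    Fin (T + 1) × Fin (T + 1) :=
  if e.1 < e.2 then clip T (N e.1 e.2 ω, Y e.1 e.2 ω) else 0

/-- The marginal probabilities of the family of counts. -/
noncomputable def countWeight [MeasurableSpace Ω] (μ : Measure Ω) (T : ℕ)
    (N Y : Fin n → Fin n → Ω → ℕ) (e : Fin n × Fin n) (v : Fin (T + 1) × Fin (T + 1)) : ℝ :=
  μ.real {ω | countFamily T N Y ω e = v}

variable [MeasurableSpace Ω] {μ : Measure Ω} {P : Fin n → Fin n → I}
  {M : Matrix (Fin n) (Fin n) ℝ} {N Y : Fin n → Fin n → Ω → ℕ}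

theorem measurable_countFamily (h : IsComparisonModel μ T P M N Y) (e : Fin n × Fin n) :
    Measurable fun ω => countFamily T N Y ω e := by
  unfold countFamily
  split_ifs
  · exact (Measurable.of_discrete (f := clip T)).comp
      ((h.measurable_N e.1 e.2).prodMk (h.measurable_Y e.1 e.2))
  · exact measurable_const

theorem wins_le (h : IsComparisonModel μ T P M N Y) {i j : Fin n} (hij : i < j) (ω : Ω) :
    Y i j ω ≤ N i j ω := by
  have := h.wins_add i j ω hij.ne
  omega

theorem countWeight_eq (h : IsComparisonModel μ T P M N Y) {i j : Fin n} (hij : i < j)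
    (v : Fin (T + 1) × Fin (T + 1)) :
    countWeight μ T N Y (i, j) v = (binomial T (P i j)).real {(v.1 : ℕ)} *
      (binomial v.1 (unitInterval.sigmoid (M i j))).real {(v.2 : ℕ)} := by
  have h1 := h.cond_law_Y i j hij v.1 v.2
  have h2 := (h.law_N i j hij).measureReal_eq (p := fun k => k = (v.1 : ℕ))
    MeasurableSet.of_discrete
  rw [show {x : ℕ | x = (v.1 : ℕ)} = {(v.1 : ℕ)} from rfl] at h2
  rw [← h2, ← h1]
  refine measureReal_congr ?_
  filter_upwards [ae_le_of_hasLaw_binomial (h.law_N i j hij)] with ω hω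
  have hY := (wins_le h hij ω).trans hω
  apply propext
  change countFamily T N Y ω (i, j) = v ↔ N i j ω = v.1 ∧ Y i j ω = v.2
  simp only [countFamily, if_pos hij, clip, Prod.ext_iff, Fin.ext_iff, min_eq_left hω,
    min_eq_left hY]

theorem sum_countWeight_mul_numComparisons (h : IsComparisonModel μ T P M N Y) {i j : Fin n}
    (hij : i < j) :
    ∑ v, countWeight μ T N Y (i, j) v * numComparisons v = T * P i j := by
  rw [Fintype.sum_prod_type]
  simp only [countWeight_eq h hij, numComparisons]
  rw [← sum_binomial_real_mul le_rfl (P i j), Finset.sum_range]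
  refine Finset.sum_congr rfl fun a _ => ?_
  rw [← Finset.sum_mul, ← Finset.mul_sum, ← Finset.sum_range fun b =>
    (binomial a (unitInterval.sigmoid (M i j))).real {b},
    sum_binomial_real (Nat.lt_succ_iff.mp a.2), mul_one]

theorem sum_countWeight_mul_numWins (h : IsComparisonModel μ T P M N Y) {i j : Fin n}
    (hij : i < j) :
    ∑ v, countWeight μ T N Y (i, j) v * numWins v = T * P i j * Real.sigmoid (M i j) := by
  rw [Fintype.sum_prod_type]
  simp only [countWeight_eq h hij, numWins]
  rw [← sum_binomial_real_mul le_rfl (P i j), Finset.sum_range, Finset.sum_mul]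
  refine Finset.sum_congr rfl fun a _ => ?_
  have ha := Nat.lt_succ_iff.mp a.2
  have h1 := sum_binomial_real_mul ha (unitInterval.sigmoid (M i j))
  rw [Finset.sum_range] at h1
  simp only [mul_assoc, ← Finset.mul_sum]
  congr 1
  refine Eq.trans (Finset.sum_congr rfl fun b _ => ?_) h1
  rcases le_total (b : ℕ) (a : ℕ) with hba | hba
  · rw [min_eq_left hba]
  · rcases hba.eq_or_lt with hba | hba
    · rw [hba, min_self]
    · rw [binomial_real_singleton, Nat.choose_eq_zero_of_lt hba]
      simp

variable [IsProbabilityMeasure μ]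

theorem sum_countWeight (h : IsComparisonModel μ T P M N Y) (e : Fin n × Fin n) :
    ∑ v, countWeight μ T N Y e v = 1 := by
  have := sum_measureReal_preimage_singleton (μ := μ) Finset.univ
    (f := fun ω => countFamily T N Y ω e)
    (fun v _ => measurable_countFamily h e (measurableSet_singleton v))
  simp only [Finset.coe_univ, Set.preimage_univ, probReal_univ] at this
  exact this

theorem measureReal_countFamily_eq (h : IsComparisonModel μ T P M N Y)
    (x : Fin n × Fin n → Fin (T + 1) × Fin (T + 1)) :
    μ.real {ω | countFamily T N Y ω = x} = ∏ e, countWeight μ T N Y e (x e) := by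
  by_cases hx : ∀ e : Fin n × Fin n, ¬ e.1 < e.2 → x e = 0
  · have hind := h.indep.measure_inter_preimage_eq_mul Finset.univ
      (sets := fun e => {c | clip T c = x e.1}) (fun e _ => MeasurableSet.of_discrete)
    rw [← Fintype.prod_subtype_mul_prod_subtype (fun e : Fin n × Fin n => e.1 < e.2)]
    have h2 : ∀ e : {e : Fin n × Fin n // ¬ e.1 < e.2}, countWeight μ T N Y e.1 (x e.1) = 1 := by
      intro e
      simp [countWeight, countFamily, e.2, hx e.1 e.2]
    have h3 : {ω | countFamily T N Y ω = x} = ⋂ e ∈ (Finset.univ :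
        Finset {e : Fin n × Fin n // e.1 < e.2}),
        (fun ω => (N e.1.1 e.1.2 ω, Y e.1.1 e.1.2 ω)) ⁻¹' {c | clip T c = x e.1} := by
      ext ω
      simp only [Set.mem_ofPred_eq, Finset.mem_univ, Set.iInter_true, Set.mem_iInter,
        Set.mem_preimage, funext_iff]
      refine ⟨fun hω e => ?_, fun hω e => ?_⟩
      · have := hω e.1
        rwa [countFamily, if_pos e.2] at this
      · by_cases he : e.1 < e.2
        · rw [countFamily, if_pos he]
          exact hω ⟨e, he⟩
        · rw [countFamily, if_neg he, hx e he]
    rw [Finset.prod_congr rfl fun e _ => h2 e, Finset.prod_const_one, mul_one, h3, measureReal_def,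
      hind, ENNReal.toReal_prod]
    refine Finset.prod_congr rfl fun e _ => ?_
    simp only [countWeight, countFamily, if_pos e.2, measureReal_def]
    rfl
  · push Not at hx
    obtain ⟨e, he, hxe⟩ := hx
    replace he : ¬ e.1 < e.2 := not_lt.mpr he
    have h1 : countWeight μ T N Y e (x e) = 0 := by
      simp [countWeight, countFamily, he, hxe.symm]
    rw [Finset.prod_eq_zero (Finset.mem_univ e) h1]
    have h2 : {ω | countFamily T N Y ω = x} = ∅ := by
      ext ω
      simp only [Set.mem_ofPred_eq, Set.mem_empty_iff_false, iff_false]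
      intro hω
      have := congrFun hω e
      rw [countFamily, if_neg he] at this
      exact hxe this.symm
    rw [h2, measureReal_empty]

open Classical in
theorem measureReal_setOf_countFamily (h : IsComparisonModel μ T P M N Y)
    (B : (Fin n × Fin n → Fin (T + 1) × Fin (T + 1)) → Prop) :
    μ.real {ω | B (countFamily T N Y ω)} =
      prodExp (countWeight μ T N Y) (fun x => if B x then 1 else 0) := by
  have := sum_measureReal_preimage_singleton (μ := μ) (Finset.univ.filter B)
    (f := fun ω => countFamily T N Y ω)
    (fun v _ => measurable_pi_lambda _ (measurable_countFamily h) (measurableSet_singleton v))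
  rw [show {ω | B (countFamily T N Y ω)} =
    (fun ω => countFamily T N Y ω) ⁻¹' ↑(Finset.univ.filter B) by ext; simp, ← this, prodExp,
    Finset.sum_filter]
  refine Finset.sum_congr rfl fun x _ => ?_
  rw [← measureReal_countFamily_eq h]
  split_ifs <;> simp [Set.preimage]

theorem sum_countWeight_of_not_lt {e : Fin n × Fin n} (he : ¬ e.1 < e.2)
    (f : Fin (T + 1) × Fin (T + 1) → ℝ) :
    ∑ v, countWeight μ T N Y e v * f v = f 0 := by
  rw [Finset.sum_eq_single 0]
  · simp [countWeight, countFamily, he]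
  · intro v _ hv
    simp [countWeight, countFamily, he, hv.symm]
  · simp

end counts

/-! ### Uniform deviation of the log-likelihood -/

section likelihood
variable {n T : ℕ}

/-- The log-likelihood ratio of the logits `a` and `b` for one pair of subjects. -/
noncomputable def pairLogRatio (v : Fin (T + 1) × Fin (T + 1)) (a b : ℝ) : ℝ :=
  (numWins v * a - numComparisons v * softplus a) - (numWins v * b - numComparisons v * softplus b)

/-- `pairLogRatio` for the entries of two matrices, set to `0` outside the strict upper triangle. -/
noncomputable def entryLogRatio (A B : Matrix (Fin n) (Fin n) ℝ) (e : Fin n × Fin n)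
    (v : Fin (T + 1) × Fin (T + 1)) : ℝ :=
  if e.1 < e.2 then pairLogRatio v (A e.1 e.2) (B e.1 e.2) else 0

theorem sum_ite_lt_eq (f : Fin n → Fin n → ℝ) :
    ∑ e : Fin n × Fin n, (if e.1 < e.2 then f e.1 e.2 else 0) =
      ∑ i, ∑ j ∈ Finset.Ioi i, f i j := by
  rw [Fintype.sum_prod_type]
  refine Finset.sum_congr rfl fun i _ => ?_
  rw [← Finset.sum_filter]
  congr 1
  ext j; simp

theorem logLik_sub_logLik {Ω : Type*} {N Y : Fin n → Fin n → Ω → ℕ} {ω : Ω}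
    (hN : ∀ i j, i < j → N i j ω ≤ T) (hY : ∀ i j, i < j → Y i j ω ≤ N i j ω)
    (A B : Matrix (Fin n) (Fin n) ℝ) :
    logLik (fun i j => N i j ω) (fun i j => Y i j ω) A -
      logLik (fun i j => N i j ω) (fun i j => Y i j ω) B =
    ∑ e, entryLogRatio A B e (countFamily T N Y ω e) := by
  have h1 : ∀ e, entryLogRatio A B e (countFamily T N Y ω e) =
      if e.1 < e.2 then (fun i j => pairLogRatio (clip T (N i j ω, Y i j ω)) (A i j) (B i j))
        e.1 e.2 else 0 := by
    intro e
    unfold entryLogRatio countFamily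
    split_ifs <;> rfl
  refine Eq.trans ?_ ((Finset.sum_congr rfl fun e _ => h1 e).trans (sum_ite_lt_eq fun i j =>
    pairLogRatio (clip T (N i j ω, Y i j ω)) (A i j) (B i j))).symm
  simp only [logLik, ← Finset.sum_sub_distrib]
  refine Finset.sum_congr rfl fun i _ => Finset.sum_congr rfl fun j hj => ?_
  have hij := Finset.mem_Ioi.mp hj
  rw [pairLogRatio, numComparisons_clip (hN i j hij), numWins_clip (hN i j hij) (hY i j hij)]
  simp only [log_sigmoid, log_one_sub_sigmoid]
  ring

theorem skew_apply {C : ℝ} {A : Matrix (Fin n) (Fin n) ℝ} (hA : A ∈ paramSpace n C) (i j : Fin n) :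
    A j i = -A i j := by
  have := congrFun (congrFun hA.2 j) i
  simpa using this

theorem frobeniusSq_winProb_sub {C : ℝ} {A B : Matrix (Fin n) (Fin n) ℝ} (hA : A ∈ paramSpace n C)
    (hB : B ∈ paramSpace n C) :
    frobeniusSq (winProb A - winProb B) =
      2 * ∑ e : Fin n × Fin n, if e.1 < e.2 then
        (Real.sigmoid (A e.1 e.2) - Real.sigmoid (B e.1 e.2)) ^ 2 else 0 := by
  set d : Fin n × Fin n → ℝ := fun e =>
    (Real.sigmoid (A e.1 e.2) - Real.sigmoid (B e.1 e.2)) ^ 2 with hd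
  have hswap : ∀ e : Fin n × Fin n, d e.swap = d e := by
    intro e
    simp only [hd, Prod.fst_swap, Prod.snd_swap, skew_apply hA e.1 e.2, skew_apply hB e.1 e.2,
      Real.sigmoid_neg]
    ring
  have hdiag : ∀ i, d (i, i) = 0 := by
    intro i
    have h1 := skew_apply hA i i
    have h2 := skew_apply hB i i
    simp only [hd]
    rw [show A i i = 0 by linarith, show B i i = 0 by linarith]
    simp
  have h1 : ∀ e : Fin n × Fin n, d e =
      (if e.1 < e.2 then d e else 0) + (if e.swap.1 < e.swap.2 then d e.swap else 0) := by
    rintro ⟨i, j⟩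
    rw [hswap]
    simp only [Prod.swap_prod_mk]
    rcases lt_trichotomy i j with h | h | h
    · simp [h, h.not_gt]
    · subst h; simp [hdiag]
    · simp [h, h.not_gt]
  have h2 : frobeniusSq (winProb A - winProb B) = ∑ e, d e := by
    rw [Fintype.sum_prod_type]
    simp [frobeniusSq, winProb, hd]
  have h3 : ∑ e : Fin n × Fin n, (if e.swap.1 < e.swap.2 then d e.swap else 0) =
      ∑ e : Fin n × Fin n, if e.1 < e.2 then d e else 0 :=
    (Equiv.prodComm (Fin n) (Fin n)).sum_comp
      (fun e : Fin n × Fin n => if e.1 < e.2 then d e else 0)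
  rw [h2, Finset.sum_congr rfl fun e _ => h1 e, Finset.sum_add_distrib, h3, ← two_mul]

variable {Ω : Type*} [MeasurableSpace Ω] {μ : Measure Ω} [IsProbabilityMeasure μ]
  {P : Fin n → Fin n → I} {M₀ : Matrix (Fin n) (Fin n) ℝ} {N Y : Fin n → Fin n → Ω → ℕ}

/-- The expected log-likelihood ratio is minus a Kullback-Leibler divergence, hence controlled by
the squared distance of the winning probabilities. -/
theorem sum_countWeight_mul_entryLogRatio_le (h : IsComparisonModel μ T P M₀ N Y) {p : ℝ}
    (hp : ∀ i j, i ≠ j → p ≤ P i j) (A : Matrix (Fin n) (Fin n) ℝ)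
    (e : Fin n × Fin n) :
    ∑ v, countWeight μ T N Y e v * entryLogRatio A M₀ e v ≤
      -(2 * T * p * if e.1 < e.2 then
        (Real.sigmoid (A e.1 e.2) - Real.sigmoid (M₀ e.1 e.2)) ^ 2 else 0) := by
  by_cases he : e.1 < e.2
  · obtain ⟨i, j⟩ := e
    simp only at he
    have h1 : ∀ v, countWeight μ T N Y (i, j) v * entryLogRatio A M₀ (i, j) v =
        (A i j - M₀ i j) * (countWeight μ T N Y (i, j) v * numWins v) -
        (softplus (A i j) - softplus (M₀ i j)) *
          (countWeight μ T N Y (i, j) v * numComparisons v) := by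
      intro v
      simp only [entryLogRatio, if_pos he, pairLogRatio]
      ring
    simp only [h1, Finset.sum_sub_distrib, ← Finset.mul_sum]
    rw [sum_countWeight_mul_numComparisons h he, sum_countWeight_mul_numWins h he, if_pos he]
    have h2 := two_mul_sq_sigmoid_sub_le (M₀ i j) (A i j)
    have h3 : (T : ℝ) * p ≤ T * P i j := mul_le_mul_of_nonneg_left (hp i j he.ne) (Nat.cast_nonneg _)
    have h4 := mul_le_mul_of_nonneg_left h2
      (mul_nonneg (Nat.cast_nonneg (α := ℝ) T) (P i j).2.1)
    have h5 := mul_le_mul_of_nonneg_right h3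
      (mul_nonneg zero_le_two (sq_nonneg (Real.sigmoid (A i j) - Real.sigmoid (M₀ i j))))
    linarith
  · rw [sum_countWeight_of_not_lt he]
    simp [entryLogRatio, he]

theorem convexOn_max_pow (m : ℕ) : ConvexOn ℝ Set.univ fun x : ℝ => max x 0 ^ m :=
  ((convexOn_id convex_univ).sup (convexOn_const 0 convex_univ)).pow
    (fun _ _ => le_max_right _ _) m

theorem monotone_max_pow (m : ℕ) : Monotone fun x : ℝ => max x 0 ^ m :=
  fun _ _ h => pow_le_pow_left₀ (le_max_right _ _) (max_le_max_right 0 h) m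

open Classical in
/-- The uniform deviation bound: with high probability the log-likelihood ratio exceeds its
expectation by at most `O(T C n √k)`, simultaneously on the whole parameter space. -/
theorem prodExp_uniform_deviation_le (h : IsComparisonModel μ T P M₀ N Y) (hT : 1 ≤ T) {C : ℝ}
    (hC : 0 < C) (hM₀ : M₀ ∈ paramSpace n C) {q : ℝ} (hq0 : 0 ≤ q) (hq1 : q ≤ 1)
    (hq : ∀ i j, i ≠ j → (P i j : ℝ) ≤ q) {k : ℕ} (hk : k ≠ 0) (hke : Even k) (hqk : n * q ≤ k)
    {τ : ℝ} (hτ : 0 < τ) :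
    prodExp (countWeight μ T N Y) (fun x => if ∃ A ∈ paramSpace n C, τ ≤
      ∑ e, (entryLogRatio A M₀ e (x e) -
        ∑ v, countWeight μ T N Y e v * entryLogRatio A M₀ e v) then 1 else 0) ≤
      ((4 * T * C * n) / τ) ^ (2 * k) * (n * (10000 * Real.exp 8 * k) ^ k) := by
  set w := countWeight μ T N Y with hw_def
  have hw : ∀ e v, 0 ≤ w e v := fun e v => measureReal_nonneg
  have hw1 : ∀ e, ∑ v, w e v = 1 := sum_countWeight h
  set B : (Fin n × Fin n → Fin (T + 1) × Fin (T + 1)) → Prop := fun x =>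
    ∃ A ∈ paramSpace n C, τ ≤
      ∑ e, (entryLogRatio A M₀ e (x e) - ∑ v, w e v * entryLogRatio A M₀ e v) with hB
  -- one witness for each bad outcome suffices, so the supremum runs over a finite index set
  have hwit : ∀ x, ∃ A ∈ paramSpace n C, B x → τ ≤
      ∑ e, (entryLogRatio A M₀ e (x e) - ∑ v, w e v * entryLogRatio A M₀ e v) := by
    intro x
    by_cases hx : B x
    · obtain ⟨A, hA, hA'⟩ := hx
      exact ⟨A, hA, fun _ => hA'⟩
    · exact ⟨M₀, hM₀, fun h => absurd h hx⟩
  choose A hA hAB using hwit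
  set F : ℝ → ℝ := fun x => max x 0 ^ (2 * k) with hF
  set s : Fin n × Fin n → Fin (T + 1) × Fin (T + 1) →
      (Fin n × Fin n → Fin (T + 1) × Fin (T + 1)) → ℝ := fun e v t =>
    if e.1 < e.2 then numComparisons v * (A t e.1 e.2 - M₀ e.1 e.2) else 0 with hs
  have h1 := prodExp_maxEntry_le (convexOn_max_pow (2 * k)) (monotone_max_pow (2 * k)) hw hw1
    (fun e v t => entryLogRatio (A t) M₀ e v) s
    (fun e v t => by
      simp only [entryLogRatio, hs]
      split_ifs
      · rw [abs_mul, abs_of_nonneg (numComparisons_nonneg v)]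
        exact abs_mul_sub_mul_softplus_sub_le (numWins_nonneg v) (numWins_le v) _ _
      · exact le_rfl)
    (fun e v t u => by
      simp only [entryLogRatio, hs, pairLogRatio]
      split_ifs
      · rw [sub_sub_sub_cancel_right, ← mul_sub, sub_sub_sub_cancel_right, abs_mul,
          abs_of_nonneg (numComparisons_nonneg v)]
        exact abs_mul_sub_mul_softplus_sub_le (numWins_nonneg v) (numWins_le v) _ _
      · exact le_rfl)
  set Nn : Fin n × Fin n → Fin (T + 1) × Fin (T + 1) → ℝ := fun e v =>
    if e.1 < e.2 then numComparisons v / T else 0 with hNn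
  have hT0 : (0 : ℝ) < T := by exact_mod_cast hT
  have h2 := prodExp_signExp_norm_pow_le (N := Nn) hw hw1
    (fun e v => by
      simp only [hNn]
      split_ifs
      · exact div_nonneg (numComparisons_nonneg v) hT0.le
      · exact le_rfl)
    (fun e v => by
      simp only [hNn]
      split_ifs
      · exact (div_le_one hT0).mpr (numComparisons_le v)
      · exact zero_le_one)
    hq0 hq1
    (fun e => by
      by_cases he : e.1 < e.2
      · obtain ⟨i, j⟩ := e
        simp only at he
        simp only [hNn, if_pos he, ← mul_div_assoc, ← Finset.sum_div]
        rw [hw_def, sum_countWeight_mul_numComparisons h he, mul_div_cancel_left₀ _ hT0.ne']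
        exact hq i j he.ne
      · rw [hw_def, sum_countWeight_of_not_lt he]
        simpa [hNn, he] using hq0)
    hk hke hqk
  -- Markov's inequality
  have h3 : ∀ x, τ ^ (2 * k) * (if B x then 1 else 0) ≤
      F (maxEntry fun t => ∑ e, (entryLogRatio (A t) M₀ e (x e) -
        ∑ v, w e v * entryLogRatio (A t) M₀ e v)) := by
    intro x
    split_ifs with hx
    · rw [mul_one]
      refine pow_le_pow_left₀ hτ.le (le_max_of_le_left ((hAB x hx).trans ?_)) _
      exact le_maxEntry (fun t => ∑ e, (entryLogRatio (A t) M₀ e (x e) -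
        ∑ v, w e v * entryLogRatio (A t) M₀ e v)) x
    · rw [mul_zero]
      exact pow_nonneg (le_max_right _ _) _
  -- the Rademacher sum is bounded by the duality of the spectral and the nuclear norm
  have h4 : ∀ (x : Fin n × Fin n → Fin (T + 1) × Fin (T + 1)) (ε : Fin n × Fin n → Bool),
      F (maxEntry fun t => ∑ e, 2 * (boolSign (ε e) * s e (x e) t)) ≤
      (4 * T * C * n) ^ (2 * k) * ‖Matrix.toEuclideanCLM (𝕜 := ℝ)
        (Matrix.of fun i j => boolSign (ε (i, j)) * Nn (i, j) (x (i, j)))‖ ^ (2 * k) := by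
    intro x ε
    set X : Matrix (Fin n) (Fin n) ℝ :=
      Matrix.of fun i j => boolSign (ε (i, j)) * Nn (i, j) (x (i, j)) with hX
    have hn0 : 0 ≤ 4 * T * C * n * ‖Matrix.toEuclideanCLM (𝕜 := ℝ) X‖ := by positivity
    rw [← mul_pow]
    refine pow_le_pow_left₀ (le_max_right _ _) (max_le (maxEntry_le fun t => ?_) hn0) _
    have e1 : ∑ e, 2 * (boolSign (ε e) * s e (x e) t) =
        2 * T * (∑ i, ∑ j, X i j * A t i j + ∑ i, ∑ j, (-X) i j * M₀ i j) := by
      rw [Fintype.sum_prod_type]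
      simp only [← Finset.sum_add_distrib, Finset.mul_sum]
      refine Finset.sum_congr rfl fun i _ => Finset.sum_congr rfl fun j _ => ?_
      simp only [hs, hX, hNn, Matrix.of_apply, Matrix.neg_apply]
      split_ifs
      · field_simp
        ring
      · ring
    have e2 := sum_mul_le_norm_mul_nuclearNorm X (A t)
    have e3 := sum_mul_le_norm_mul_nuclearNorm (-X) M₀
    rw [map_neg, norm_neg] at e3
    have e4 := mul_le_mul_of_nonneg_left (hA t).1
      (norm_nonneg (Matrix.toEuclideanCLM (𝕜 := ℝ) X))
    have e5 := mul_le_mul_of_nonneg_left hM₀.1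
      (norm_nonneg (Matrix.toEuclideanCLM (𝕜 := ℝ) X))
    rw [e1]
    have e6 := mul_le_mul_of_nonneg_left
      (add_le_add (e2.trans e4) (e3.trans e5)) (show (0 : ℝ) ≤ 2 * T by positivity)
    linarith
  have h5 : τ ^ (2 * k) * prodExp w (fun x => if B x then 1 else 0) ≤
      (4 * T * C * n) ^ (2 * k) * (n * (10000 * Real.exp 8 * k) ^ k) := by
    rw [← prodExp_mul_left]
    refine (prodExp_mono hw h3).trans (h1.trans ?_)
    refine (prodExp_mono hw fun x => signExp_mono (h4 x)).trans ?_
    have e1 : ∀ x : Fin n × Fin n → Fin (T + 1) × Fin (T + 1),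
        signExp (fun ε : Fin n × Fin n → Bool =>
        (4 * T * C * n) ^ (2 * k) * ‖Matrix.toEuclideanCLM (𝕜 := ℝ)
        (Matrix.of fun i j => boolSign (ε (i, j)) * Nn (i, j) (x (i, j)))‖ ^ (2 * k)) =
        (4 * T * C * n) ^ (2 * k) * signExp (fun ε => ‖Matrix.toEuclideanCLM (𝕜 := ℝ)
        (Matrix.of fun i j => boolSign (ε (i, j)) * Nn (i, j) (x (i, j)))‖ ^ (2 * k)) :=
      fun x => prodExp_mul_left _ _
    simp only [e1]
    rw [prodExp_mul_left]
    exact mul_le_mul_of_nonneg_left h2 (by positivity)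
  rw [div_pow, div_mul_eq_mul_div, le_div_iff₀ (by positivity), mul_comm]
  exact h5

end likelihood

/-! ### The error of the maximum likelihood estimator -/

section consistency
variable {n T : ℕ} {Ω : Type*} [MeasurableSpace Ω] {μ : Measure Ω} [IsProbabilityMeasure μ]
  {P : Fin n → Fin n → I} {M₀ : Matrix (Fin n) (Fin n) ℝ} {N Y : Fin n → Fin n → Ω → ℕ}

/-- The basic inequality: a parameter that is at least as likely as the true one is close to it,
unless the log-likelihood ratio deviates from its expectation. -/
theorem mul_frobeniusSq_le (h : IsComparisonModel μ T P M₀ N Y) {C p : ℝ}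
    (hM₀ : M₀ ∈ paramSpace n C) (hp : ∀ i j, i ≠ j → p ≤ P i j)
    {ω : Ω} (hN : ∀ i j, i < j → N i j ω ≤ T) {A : Matrix (Fin n) (Fin n) ℝ}
    (hA : IsConstrainedMLE C (fun i j => N i j ω) (fun i j => Y i j ω) A) :
    T * p * frobeniusSq (winProb A - winProb M₀) ≤
      ∑ e, (entryLogRatio A M₀ e (countFamily T N Y ω e) -
        ∑ v, countWeight μ T N Y e v * entryLogRatio A M₀ e v) := by
  have h1 := logLik_sub_logLik hN (fun i j hij => wins_le h hij ω) A M₀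
  have h2 : 0 ≤ ∑ e, entryLogRatio A M₀ e (countFamily T N Y ω e) :=
    h1 ▸ sub_nonneg.mpr (hA.2 hM₀)
  have h3 := Finset.sum_le_sum fun e (_ : e ∈ Finset.univ) =>
    sum_countWeight_mul_entryLogRatio_le h hp A e
  rw [Finset.sum_neg_distrib, ← Finset.mul_sum] at h3
  rw [Finset.sum_sub_distrib, frobeniusSq_winProb_sub hA.1 hM₀]
  linarith

/-- The uniform deviation bound turned into a probability bound for the error of the maximizers. -/
theorem one_sub_le_measureReal_mle (h : IsComparisonModel μ T P M₀ N Y) (hT : 1 ≤ T) {C : ℝ}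
    (hC : 0 < C) (hM₀ : M₀ ∈ paramSpace n C) {p q : ℝ} (hq0 : 0 ≤ q) (hq1 : q ≤ 1)
    (hp : ∀ i j, i ≠ j → p ≤ P i j) (hp0 : 0 < p)
    (hq : ∀ i j, i ≠ j → (P i j : ℝ) ≤ q) {k : ℕ} (hk : k ≠ 0) (hke : Even k) (hqk : n * q ≤ k)
    {D : ℝ} (hD : 0 < D) :
    1 - ((4 * C * n) / (p * D)) ^ (2 * k) * (n * (10000 * Real.exp 8 * k) ^ k) ≤
      μ.real {ω | (∃ A, IsConstrainedMLE C (fun i j => N i j ω) (fun i j => Y i j ω) A) ∧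
        ∀ A, IsConstrainedMLE C (fun i j => N i j ω) (fun i j => Y i j ω) A →
          frobeniusSq (winProb A - winProb M₀) ≤ D} := by
  classical
  have hT0 : (0 : ℝ) < T := by exact_mod_cast hT
  set G := {ω | (∃ A, IsConstrainedMLE C (fun i j => N i j ω) (fun i j => Y i j ω) A) ∧
        ∀ A, IsConstrainedMLE C (fun i j => N i j ω) (fun i j => Y i j ω) A →
          frobeniusSq (winProb A - winProb M₀) ≤ D}
  set B : (Fin n × Fin n → Fin (T + 1) × Fin (T + 1)) → Prop := fun x =>
    ∃ A ∈ paramSpace n C, T * p * D ≤ ∑ e, (entryLogRatio A M₀ e (x e) -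
        ∑ v, countWeight μ T N Y e v * entryLogRatio A M₀ e v) with hB
  have h1 : μ.real {ω | B (countFamily T N Y ω)} ≤
      ((4 * C * n) / (p * D)) ^ (2 * k) * (n * (10000 * Real.exp 8 * k) ^ k) := by
    rw [measureReal_setOf_countFamily h]
    have := prodExp_uniform_deviation_le h hT hC hM₀ hq0 hq1 hq hk hke hqk
      (τ := T * p * D) (by positivity)
    rw [show 4 * T * C * n / (T * p * D) = 4 * C * n / (p * D) by field_simp] at this
    convert this
  have h2 : ∀ᵐ ω ∂μ, ∀ i j, i < j → N i j ω ≤ T := by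
    refine ae_all_iff.mpr fun i => ae_all_iff.mpr fun j => ?_
    by_cases hij : i < j
    · filter_upwards [ae_le_of_hasLaw_binomial (h.law_N i j hij)] with ω hω _ using hω
    · exact Filter.Eventually.of_forall fun ω h => absurd h hij
  have h3 : μ.real Gᶜ ≤ μ.real {ω | B (countFamily T N Y ω)} := by
    refine ENNReal.toReal_mono (measure_ne_top _ _) (measure_mono_ae ?_)
    filter_upwards [h2] with ω hω hG
    obtain ⟨A, hA, hAD⟩ : ∃ A, IsConstrainedMLE C (fun i j => N i j ω) (fun i j => Y i j ω) A ∧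
        D < frobeniusSq (winProb A - winProb M₀) := by
      by_contra! hcon
      exact hG ⟨exists_isConstrainedMLE hM₀ _ _, hcon⟩
    exact ⟨A, hA.1, (mul_le_mul_of_nonneg_left hAD.le (by positivity)).trans
      (mul_frobeniusSq_le h hM₀ hp hω hA)⟩
  have h4 := measureReal_union_le (μ := μ) G Gᶜ
  rw [Set.union_compl_self, probReal_univ] at h4
  linarith

end consistency

theorem theorem1 (T : ℕ) (hT : 1 ≤ T) (δ₁ δ₂ : ℝ) (hδ₁ : 0 < δ₁) (hδ₂ : 0 < δ₂) :
    ∃ κ₁ κ₂ : ℝ, 0 < κ₁ ∧ 0 < κ₂ ∧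
      ∀ (n : ℕ), 2 ≤ n →
      ∀ (C : ℝ), 0 < C →
      ∀ (p q : ℝ), 0 ≤ p → p ≤ q → q ≤ 1 → q ≤ δ₁ * p → Real.log n / n ≤ δ₂ * p →
      ∀ (P : Fin n → Fin n → I), (∀ i j, P i j = P j i) →
        (∀ i j, i ≠ j → p ≤ (P i j : ℝ) ∧ (P i j : ℝ) ≤ q) →
      ∀ (Mstar : Matrix (Fin n) (Fin n) ℝ), Mstar ∈ paramSpace n C →
      ∀ (Ω : Type*) [MeasurableSpace Ω] (μ : Measure Ω) [IsProbabilityMeasure μ]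
        (N Y : Fin n → Fin n → Ω → ℕ), IsComparisonModel μ T P Mstar N Y →
        1 - κ₁ / n ≤ μ.real {ω |
          (∃ Mhat, IsConstrainedMLE C (fun i j => N i j ω) (fun i j => Y i j ω) Mhat) ∧
          ∀ Mhat, IsConstrainedMLE C (fun i j => N i j ω) (fun i j => Y i j ω) Mhat →
            1 / ((n : ℝ) ^ 2 - n) * frobeniusSq (winProb Mhat - winProb Mstar) ≤
              κ₂ * C * √(1 / (p * n))} := by
  have hlog2 : 0 < Real.log 2 := Real.log_pos one_lt_two
  set c : ℝ := 2 * (δ₁ + δ₂ + δ₂ / Real.log 2) with hc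
  have hc0 : 0 < c := by positivity
  set B : ℝ := 10000 * Real.exp 8 with hB
  have hB0 : 0 < B := by positivity
  refine ⟨1, 8 * Real.exp 1 * √(B * c), one_pos, by positivity, ?_⟩
  intro n hn C hC p q hp0 hpq hq1 hqp hnp P _ hPpq M₀ hM₀ Ω _ μ _ N Y hmodel
  have hn2 : (2 : ℝ) ≤ n := by exact_mod_cast hn
  have hn0 : (0 : ℝ) < n := by linarith
  have hlogn : Real.log 2 ≤ Real.log n := Real.log_le_log two_pos hn2
  have hlogpn : Real.log n ≤ δ₂ * (p * n) := by
    rw [div_le_iff₀ hn0] at hnp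
    linarith
  have hpn : 0 < p * n := by
    by_contra! hcon
    have := mul_nonpos_of_nonneg_of_nonpos hδ₂.le hcon
    linarith
  have hp : 0 < p := pos_of_mul_pos_left hpn hn0.le
  have hq0 : 0 ≤ q := hp0.trans hpq
  -- the order of the moment: at least `log n` and `n q`, and at most of the order of `p n`
  set k : ℕ := 2 * ⌈n * q + Real.log n⌉₊ with hk
  have hceil := Nat.le_ceil (n * q + Real.log n)
  have hceil' := Nat.ceil_lt_add_one (a := n * q + Real.log n) (by positivity)
  have hkr : (k : ℝ) = 2 * ⌈n * q + Real.log n⌉₊ := by rw [hk]; push_cast; rfl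
  have hnq : 0 ≤ n * q := by positivity
  have hklog : Real.log n ≤ k := by rw [hkr]; linarith
  have hkq : n * q ≤ k := by rw [hkr]; linarith
  have hk0 : (0 : ℝ) < k := by linarith
  have hkc : (k : ℝ) ≤ c * (p * n) := by
    have h1 : n * q ≤ δ₁ * (p * n) := by
      have := mul_le_mul_of_nonneg_left hqp hn0.le
      linarith
    have h2 : 1 ≤ δ₂ / Real.log 2 * (p * n) := by
      rw [div_mul_eq_mul_div, le_div_iff₀ hlog2]
      linarith
    rw [hkr, hc]
    linarith
  set D : ℝ := 4 * C * n * (√(B * k) * Real.exp 1) / p with hD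
  have hBk : 0 < √(B * k) := Real.sqrt_pos.mpr (by positivity)
  have hD0 : 0 < D := by positivity
  have hmain := one_sub_le_measureReal_mle hmodel hT hC hM₀ hq0 hq1 (fun i j hij => (hPpq i j hij).1)
    hp (fun i j hij => (hPpq i j hij).2) (Nat.cast_ne_zero.mp hk0.ne') (even_two_mul _) hkq hD0
  have hprob : (4 * C * n / (p * D)) ^ (2 * k) * (n * (B * k) ^ k) ≤ 1 / n := by
    have h1 : 4 * C * n / (p * D) = (√(B * k) * Real.exp 1)⁻¹ := by
      rw [hD]; field_simp
    have h2 : (√(B * k) * Real.exp 1) ^ (2 * k) = (B * k) ^ k * Real.exp (2 * k) := by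
      rw [mul_pow, pow_mul, Real.sq_sqrt (by positivity), ← Real.exp_nat_mul]
      push_cast
      rw [mul_one]
    have h3 : (n : ℝ) * n ≤ Real.exp (2 * k) := by
      rw [two_mul, Real.exp_add]
      have : (n : ℝ) ≤ Real.exp k := by
        rw [← Real.log_le_iff_le_exp hn0]
        exact hklog
      gcongr
    rw [h1, inv_pow, h2, ← div_eq_inv_mul, div_le_div_iff₀ (by positivity) hn0]
    have : 0 < (B * k) ^ k := by positivity
    nlinarith
  have hDle : D ≤ (n ^ 2 - n) * (8 * Real.exp 1 * √(B * c) * C * √(1 / (p * n))) := by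
    have h1 : √(B * k) ≤ √(B * c) * √(p * n) := by
      rw [← Real.sqrt_mul (by positivity)]
      apply Real.sqrt_le_sqrt
      rw [mul_assoc B c]
      exact mul_le_mul_of_nonneg_left hkc hB0.le
    have h2 : √(1 / (p * n)) = √(p * n) / (p * n) := by
      rw [Real.sqrt_div' _ hpn.le, Real.sqrt_one, div_eq_div_iff (Real.sqrt_pos.mpr hpn).ne' hpn.ne',
        one_mul, Real.mul_self_sqrt hpn.le]
    have h3 : (n : ℝ) * n / 2 ≤ n ^ 2 - n := by nlinarith
    calc D ≤ 4 * C * n * (√(B * c) * √(p * n) * Real.exp 1) / p := by rw [hD]; gcongr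
      _ = (n * n / 2) * (8 * Real.exp 1 * √(B * c) * C * √(1 / (p * n))) := by
        rw [h2]; field_simp; ring
      _ ≤ _ := by gcongr
  have hpos : (0 : ℝ) < n ^ 2 - n := by nlinarith
  refine le_trans (by linarith) (hmain.trans (measureReal_mono ?_))
  rintro ω ⟨hex, hω⟩
  refine ⟨hex, fun A hA => ?_⟩
  rw [one_div, inv_mul_le_iff₀ hpos]
  exact (hω A hA).trans hDle
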